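/- Work with subsets of $\omega$ modulo finite sets: a family of subsets of $\omega$ is *centered* if each of its finite subfamilies has infinite intersection; write $a^1=a$ and $a^0=\omega\setminus a$, and $a\subseteq^* b$ if $a\setminus b$ is finite. For a set $X$ let $\mathbf C_X$ be the set of finite partial functions from $X$ to $2$; a set $D\subseteq\mathbf C_X$ is *dense* if each $h\in\mathbf C_X$ is extended by some $g\in D$; for dense $C,D\subseteq\mathbf C_X$, $C$ *refines* $D$ if each $h\in C$ extends some $g\in D$. A set $\mathcal A$ of infinite subsets of $\omega$ is an *independent system* if $\{a^{f(a)}\mid a\in\mathcal A\}$ is centered for every $f\colon\mathcal A\to 2$. For $h\in\mathbf C_{\mathcal A}$ put $\mathcal A^h=\bigcap\{a^{h(a)}\mid a\in\operatorname{dom}h\}$ (with $\mathcal A^\emptyset=\omega$). The system $\mathcal A$ is *dense* if for each $X\subseteq\omega$ the set of those $h$ with $\mathcal A^h\subseteq^* X$ or $\mathcal A^h\cap X$ finite is dense in $\mathbf C_{\mathcal A}$. Let $\mathscr F_{\mathcal A}$ be the filter on $\omega$ generated by the sets $\bigcup\{\mathcal A^h\mid h\in D\}$, where $D$ runs over the dense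 subsets of $\mathbf C_{\mathcal A}$. A sequence $B=\langle a_\alpha\mid\alpha<\gamma\rangle$ of subsets of $\omega$, $\gamma$ an ordinal, is a *free sequence* if for each $\beta\le\gamma$ the family $\{a_\alpha\mid\alpha<\beta\}\cup\{\omega\setminus a_\alpha\mid\beta\le\alpha<\gamma\}$ is centered. It is *maximal* if there is no $X\subseteq\omega$ for which the end-extension $B^\frown\langle X\rangle$ is a free sequence. For a dense independent system $\mathcal A$, a free sequence $B$ is *associated with* $\mathcal A$ if $B$ is maximal and the sets $a_\alpha$ together with the cofinite sets generate the filter $\mathscr F_{\mathcal A}$. **Theorem.** Let $V\subseteq W$ be transitive models (sets or classes) of ZFC. Let $\mathcal A\in V$ be a dense independent system in $V$, and let $B\in V$ be, in $V$, a maximal free sequence associated with $\mathcal A$. Suppose that - $W$ is a *Cohen-preserving* extension of $V$: each dense $D\subseteq\mathbf C_\omega$ with $D\in W$ is refined by some dense $C\subseteq\mathbf C_\omega$ with $C\in V$; - each subset of $\mathcal A$ that belongs to $W$ and is countable in $W$ is contained in a set that belongs to $V$ and is countable in $V$ (this holds, for instance, if $W$ is a generic extension of $V$ by a proper forcing); -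 $\mathcal A$ remains a dense independent system in $W$. Then, in $W$, $B$ is a maximal free sequence associated with $\mathcal A$. -/

import Mathlib

universe u

noncomputable section

/-! ### Transitive models of ZFC -/

/-- The only symbol of the language of set theory: a binary relation. -/
inductive MemRel : ℕ → Type
  | mem : MemRel 2

/-- The first-order language of set theory. -/
def setLanguage : FirstOrder.Language := ⟨fun _ => Empty, MemRel⟩

/-- A type with a binary relation `E`, as a structure for the language of set theory. -/
@[reducible] def setStructure {α : Type*} (E : α → α → Prop) : setLanguage.Structure α where
  funMap := fun f => f.elim
  RelMap := fun r => match r with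
    | .mem => fun x => E (x 0) (x 1)

/-- `(α, E)` satisfies every axiom of ZFC. The two schemes range over all formulas of the
language of set theory, with arbitrary parameters from `α`. -/
structure ModelsZFC {α : Type*} (E : α → α → Prop) : Prop where
  nonempty : Nonempty α
  extensionality : ∀ x y, (∀ z, E z x ↔ E z y) → x = y
  foundation : ∀ x, (∃ y, E y x) → ∃ y, E y x ∧ ∀ z, E z x → ¬ E z y
  pairing : ∀ x y, ∃ p, ∀ z, E z p ↔ z = x ∨ z = y
  union : ∀ x, ∃ s, ∀ z, E z s ↔ ∃ y, E y x ∧ E z y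
  powerset : ∀ x, ∃ p, ∀ y, E y p ↔ ∀ z, E z y → E z x
  infinity : ∃ x, (∃ e, E e x ∧ ∀ z, ¬ E z e) ∧
    ∀ y, E y x → ∃ s, E s x ∧ ∀ z, E z s ↔ E z y ∨ z = y
  separation : letI := setStructure E
    ∀ S : Set α, (Set.univ : Set α).Definable₁ setLanguage S →
      ∀ x, ∃ y, ∀ z, E z y ↔ E z x ∧ z ∈ S
  replacement : letI := setStructure E
    ∀ R : Set (α × α), (Set.univ : Set α).Definable₂ setLanguage R →
      ∀ x, (∀ y, E y x → ∀ z z', (y, z) ∈ R → (y, z') ∈ R → z = z') →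
        ∃ w, ∀ z, E z w ↔ ∃ y, E y x ∧ (y, z) ∈ R
  choice : ∀ x, (∀ y, E y x → ∃ z, E z y) →
    (∀ y y', E y x → E y' x → (∃ z, E z y ∧ E z y') → y = y') →
      ∃ c, ∀ y, E y x → ∃! z, E z y ∧ E z c

/-- A transitive class (possibly a set) `M` of sets that, with the true membership relation, is a
model of ZFC. -/
structure IsTransitiveModel (M : Set ZFSet.{u}) : Prop where
  transitive : ∀ x ∈ M, ∀ y ∈ x, y ∈ M
  models : ModelsZFC (fun x y : M => x.1 ∈ y.1)

/-! ### Subsets of `ω` -/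

/-- The von Neumann numeral `n`. -/
def numeral : ℕ → ZFSet.{u}
  | 0 => ∅
  | n + 1 => insert (numeral n) (numeral n)

/-- The set of natural numbers coded by a set `x ⊆ ω`. -/
def natSet (x : ZFSet.{u}) : Set ℕ := {n | numeral n ∈ x}

/-- A family of subsets of `ω` is centered, as a family in `P(ω)/fin`: every finite subfamily has
infinite intersection. -/
def Centered (S : Set (Set ℕ)) : Prop :=
  ∀ T ⊆ S, T.Finite → (⋂₀ T).Infinite

/-! ### Cohen posets -/

/-- `h` is a finite partial function from `X` to `2 = {0, 1}`, i.e. an element of the Cohen poset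
`C_X`. -/
def IsCohen (X h : ZFSet.{u}) : Prop :=
  h ⊆ ZFSet.prod X {numeral 0, numeral 1} ∧ (h : Set ZFSet.{u}).Finite ∧
    ∀ x i j, ZFSet.pair x i ∈ h → ZFSet.pair x j ∈ h → i = j

/-- `D` is a dense subset of `C_X` (ordered by reverse inclusion). -/
def IsCohenDense (X D : ZFSet.{u}) : Prop :=
  (∀ h ∈ D, IsCohen X h) ∧ ∀ h, IsCohen X h → ∃ g ∈ D, h ⊆ g

/-- `C` refines `D`. -/
def Refines (C D : ZFSet.{u}) : Prop :=
  ∀ h ∈ C, ∃ g ∈ D, g ⊆ h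

/-- `W` is Cohen-preserving over `V`: every dense subset of `C = C_ω` in `W` is refined by a dense
subset of `C` in `V`. -/
def CohenPreserving (V W : Set ZFSet.{u}) : Prop :=
  ∀ D ∈ W, IsCohenDense ZFSet.omega D → ∃ C ∈ V, IsCohenDense ZFSet.omega C ∧ Refines C D

/-- `x` is countable in `M`: some injection of `x` into `ω` is an element of `M`. -/
def CountableIn (M : Set ZFSet.{u}) (x : ZFSet.{u}) : Prop :=
  ∃ f ∈ M, ZFSet.IsFunc x ZFSet.omega f ∧
    ∀ y z n, ZFSet.pair y n ∈ f → ZFSet.pair z n ∈ f → y = z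

/-- Countable covering for subsets of `X`: every subset of `X` that belongs to `W` and is countable
there is contained in a set that belongs to `V` and is countable in `V`. -/
def CountableCovering (V W : Set ZFSet.{u}) (X : ZFSet.{u}) : Prop :=
  ∀ a ∈ W, a ⊆ X → CountableIn W a → ∃ b ∈ V, CountableIn V b ∧ a ⊆ b

/-! ### Independent systems -/

/-- `A` is an independent system: a set of infinite subsets of `ω` such that
`{a ^ f(a) | a ∈ A}` is centered for every `f : A → 2`. -/
def IsIndependent (A : ZFSet.{u}) : Prop :=
  (∀ a ∈ A, a ⊆ ZFSet.omega ∧ (natSet a).Infinite) ∧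
    ∀ f : ZFSet.{u} → Bool,
      Centered {s | ∃ a ∈ A, s = if f a = true then natSet a else (natSet a)ᶜ}

/-- The set `A ^ h = ⋂ {a ^ h(a) | a ∈ dom h}` for a finite partial function `h` from `A` to `2`
(all of `ω` if `h` is empty). -/
def cohenInter (h : ZFSet.{u}) : Set ℕ :=
  {n | ∀ a, (ZFSet.pair a (numeral 1) ∈ h → n ∈ natSet a) ∧
    (ZFSet.pair a (numeral 0) ∈ h → n ∉ natSet a)}

/-- `h` reaps `X`: either `A ^ h ⊆* X` or `A ^ h ∩ X =* ∅`. -/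
def Reaps (h X : ZFSet.{u}) : Prop :=
  (cohenInter h \ natSet X).Finite ∨ (cohenInter h ∩ natSet X).Finite

/-- `A` is a dense independent system in the model `M`: it is independent and, for each `X ⊆ ω` in
`M`, the finite partial functions that reap `X` are dense in `C_A`. -/
def IsDenseSystem (M : Set ZFSet.{u}) (A : ZFSet.{u}) : Prop :=
  IsIndependent A ∧ ∀ X ∈ M, X ⊆ ZFSet.omega →
    ∀ h, IsCohen A h → ∃ g, IsCohen A g ∧ h ⊆ g ∧ Reaps g X

/-- The filter generated by the sets `F(D) = ⋃ {A ^ h | h ∈ D}`, for `D` a dense subset of `C_A`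
in `M`. The filter `F_A` as computed in `M` consists of its elements that belong to `M`. -/
def densityFilter (M : Set ZFSet.{u}) (A : ZFSet.{u}) : Filter ℕ :=
  Filter.generate {S | ∃ D ∈ M, IsCohenDense A D ∧ S = {n | ∃ h ∈ D, n ∈ cohenInter h}}

/-! ### Free sequences -/

/-- `B = ⟨a_α | α < γ⟩` is a free sequence (of ordinal length `γ`) in `P(ω)/fin`: for each `β ≤ γ`
the family `{a_α | α < β} ∪ {ω \ a_α | β ≤ α < γ}` is centered. -/
def IsFreeSequence (γ B : ZFSet.{u}) : Prop :=
  γ.IsOrdinal ∧ ZFSet.IsFunc γ (ZFSet.powerset ZFSet.omega) B ∧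
    ∀ β, β ∈ γ ∨ β = γ →
      Centered {s | ∃ α a, ZFSet.pair α a ∈ B ∧
        ((α ∈ β ∧ s = natSet a) ∨ (α ∉ β ∧ s = (natSet a)ᶜ))}

/-- `B` is a maximal free sequence in `M`: no end-extension of `B` by one further set
`X ⊆ ω` in `M` is a free sequence. -/
def IsMaximalFreeSequence (M : Set ZFSet.{u}) (γ B : ZFSet.{u}) : Prop :=
  IsFreeSequence γ B ∧ ∀ X ∈ M, X ⊆ ZFSet.omega →
    ¬ IsFreeSequence (insert γ γ) (insert (ZFSet.pair γ X) B)

/-- The filter on `ω` generated by the terms of `B` in `P(ω)/fin`, i.e. together with the cofinite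
sets. -/
def sequenceFilter (B : ZFSet.{u}) : Filter ℕ :=
  Filter.generate ({S | ∃ α a, ZFSet.pair α a ∈ B ∧ S = natSet a} ∪ {S | Sᶜ.Finite})

/-- In `M`, `B` is a free sequence associated with `A`: it is a maximal free sequence and it
generates the filter `F_A`. -/
def IsAssociated (M : Set ZFSet.{u}) (A γ B : ZFSet.{u}) : Prop :=
  IsMaximalFreeSequence M γ B ∧
    ∀ X ∈ M, X ⊆ ZFSet.omega → (natSet X ∈ sequenceFilter B ↔ natSet X ∈ densityFilter M A)

end

/-!
The filter `F_A` computed in `W` is the one computed in `V`. If `D ∈ W` is dense in `C_A`, then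
closing off under a choice of extensions in `D` gives a set `b ⊆ A`, countable in `W`, such that the
conditions of `D` with domain in `b` are dense in `C_b`. Covering puts `b` inside a set countable
in `V`, so this dense set can be transported to `C_ω`, refined there by a dense set of `V`, and the
refinement pulled back to a dense subset of `C_A` in `V`. Hence `B` still generates `F_A` in `W`.

Suppose now that `B ⌢ ⟨X⟩` is a free sequence for some `X ∈ W`. Then `X` meets every set of `F_A`
in an infinite set, and the density of `A` in `W` yields a condition `h` with `A ^ h ⊆* X`: else the
conditions `k` with `A ^ k ∩ X` finite would be dense and put the complement of `X` into `F_A`. Then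
`B ⌢ ⟨A ^ h⟩` is a free sequence as well. As `A ^ h ∈ V`, this contradicts the maximality of `B` in
`V`.
-/

/-! ### Definability over transitive models -/

/-- A class of sets, with the true membership relation, as a structure for the language of set
theory. -/
@[reducible] instance memStructure (M : Set ZFSet.{u}) : setLanguage.Structure M :=
  setStructure fun x y : M => x.1 ∈ y.1

/-- The relation `P` between sets, restricted to `M`, is first-order definable over `(M, ∈)` with
parameters from `M`. -/
@[fun_prop] def DefinableRel (M : Set ZFSet.{u}) {n : ℕ} (P : (Fin n → ZFSet.{u}) → Prop) : Prop :=
  (Set.univ : Set M).Definable setLanguage {v : Fin n → M | P fun i => v i}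

/-- `M` is closed under the operation `T` on sets, and the restriction of `T` to `M` is first-order
definable over `(M, ∈)` with parameters from `M`. -/
@[fun_prop] def DefinableOp (M : Set ZFSet.{u}) {n : ℕ} (T : (Fin n → ZFSet.{u}) → ZFSet.{u}) :
    Prop :=
  ∃ F : (Fin n → M) → M, (∀ v, (F v : ZFSet.{u}) = T fun i => v i) ∧
    (Set.univ : Set M).DefinableFun setLanguage F

section Definability

variable {M : Set ZFSet.{u}} {n m : ℕ} {P Q : (Fin n → ZFSet.{u}) → Prop}
  {T S : (Fin n → ZFSet.{u}) → ZFSet.{u}}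

theorem DefinableRel.congr (hP : DefinableRel M P)
    (hPQ : ∀ v, (∀ i, v i ∈ M) → (P v ↔ Q v)) : DefinableRel M Q := by
  unfold DefinableRel at *
  convert! hP using 1
  ext v
  exact (hPQ _ fun i => (v i).2).symm

@[fun_prop]
theorem DefinableRel.and (hP : DefinableRel M P) (hQ : DefinableRel M Q) :
    DefinableRel M fun v => P v ∧ Q v :=
  Set.Definable.inter hP hQ

@[fun_prop]
theorem DefinableRel.or (hP : DefinableRel M P) (hQ : DefinableRel M Q) :
    DefinableRel M fun v => P v ∨ Q v :=
  Set.Definable.union hP hQ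

@[fun_prop]
theorem DefinableRel.not (hP : DefinableRel M P) : DefinableRel M fun v => ¬ P v :=
  Set.Definable.compl hP

@[fun_prop]
theorem DefinableRel.imp (hP : DefinableRel M P) (hQ : DefinableRel M Q) :
    DefinableRel M fun v => P v → Q v :=
  (hP.not.or hQ).congr fun _ _ => imp_iff_not_or.symm

@[fun_prop]
theorem DefinableRel.iff (hP : DefinableRel M P) (hQ : DefinableRel M Q) :
    DefinableRel M fun v => P v ↔ Q v :=
  ((hP.imp hQ).and (hQ.imp hP)).congr fun _ _ => iff_def.symm

theorem DefinableRel.exists {P : ZFSet.{u} → (Fin n → ZFSet.{u}) → Prop}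
    (hP : DefinableRel M fun w : Fin (n + 1) → ZFSet.{u} => P (w 0) fun i => w i.succ) :
    DefinableRel M fun v => ∃ z ∈ M, P z v := by
  have h := Set.Definable.exists_of_finite (α := Fin n) (β := Fin 1)
    (Set.Definable.preimage_comp (Fin.cons (Sum.inr 0) Sum.inl) hP)
  unfold DefinableRel
  convert! h using 1
  ext v
  simp only [Set.mem_ofPred_eq, Set.mem_preimage, Function.comp_apply, Fin.cons_zero,
    Fin.cons_succ, Sum.elim_inl, Sum.elim_inr]
  exact ⟨fun ⟨z, hz, h⟩ => ⟨fun _ => ⟨z, hz⟩, h⟩, fun ⟨z, h⟩ => ⟨_, (z 0).2, h⟩⟩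

theorem DefinableRel.forall {P : ZFSet.{u} → (Fin n → ZFSet.{u}) → Prop}
    (hP : DefinableRel M fun w : Fin (n + 1) → ZFSet.{u} => P (w 0) fun i => w i.succ) :
    DefinableRel M fun v => ∀ z ∈ M, P z v :=
  (DefinableRel.exists (P := fun z v => ¬ P z v) hP.not).not.congr fun v _ => by push Not; rfl

theorem DefinableRel.comp {P : (Fin m → ZFSet.{u}) → Prop}
    {T : Fin m → (Fin n → ZFSet.{u}) → ZFSet.{u}}
    (hP : DefinableRel M P) (hT : ∀ i, DefinableOp M (T i)) :
    DefinableRel M fun v => P fun i => T i v := by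
  choose F hF hdef using hT
  simpa only [DefinableRel, Set.preimage_ofPred_eq, hF] using
    Set.Definable.preimage_map (F := fun v i => F i v) hdef hP

theorem DefinableOp.comp {T : (Fin m → ZFSet.{u}) → ZFSet.{u}}
    {S : Fin m → (Fin n → ZFSet.{u}) → ZFSet.{u}}
    (hT : DefinableOp M T) (hS : ∀ i, DefinableOp M (S i)) :
    DefinableOp M fun v => T fun i => S i v := by
  obtain ⟨F, hF, hFdef⟩ := hT
  choose G hG hGdef using hS
  exact ⟨fun v => F fun i => G i v, fun v => by simp only [hF, hG],
    Set.DefinableFun.comp hGdef hFdef⟩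

theorem DefinableOp.apply_mem (hT : DefinableOp M T) {v : Fin n → ZFSet.{u}} (hv : ∀ i, v i ∈ M) :
    T v ∈ M := by
  obtain ⟨F, hF, -⟩ := hT
  simpa only [hF] using (F fun i => ⟨v i, hv i⟩).2

@[fun_prop]
theorem DefinableOp.var (i : Fin n) : DefinableOp M fun v : Fin n → ZFSet.{u} => v i :=
  ⟨fun v => v i, fun _ => rfl, .proj setLanguage⟩

@[fun_prop]
theorem DefinableOp.const {c : ZFSet.{u}} (hc : c ∈ M) :
    DefinableOp M fun _ : Fin n → ZFSet.{u} => c :=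
  ⟨fun _ => ⟨c, hc⟩, fun _ => rfl, setLanguage.definableFun_const _ (Set.mem_univ _)⟩

@[fun_prop]
theorem DefinableRel.mem (hT : DefinableOp M T) (hS : DefinableOp M S) :
    DefinableRel M fun v => T v ∈ S v := by
  have hmem : DefinableRel M fun v : Fin 2 → ZFSet.{u} => v 0 ∈ v 1 :=
    ⟨FirstOrder.Language.Relations.formula (L := setLanguage.withConstants (Set.univ : Set M))
      (Sum.inl MemRel.mem) ![.var 0, .var 1], rfl⟩
  exact hmem.comp (T := ![T, S]) (Fin.forall_fin_two.2 ⟨hT, hS⟩)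

@[fun_prop]
theorem DefinableRel.eq (hT : DefinableOp M T) (hS : DefinableOp M S) :
    DefinableRel M fun v => T v = S v := by
  obtain ⟨F, hF, hFdef⟩ := hT
  obtain ⟨G, hG, hGdef⟩ := hS
  simpa only [DefinableRel, ← hF, ← hG, SetCoe.ext_iff] using hFdef.ofPred_eq hGdef

end Definability

@[elab_as_elim]
theorem finite_coe_induction {p : (x : ZFSet.{u}) → (x : Set ZFSet.{u}).Finite → Prop}
    (empty : p ∅ (by simp))
    (insert : ∀ a x hx, p x hx → p (insert a x) (by simpa using hx.insert a))
    (x : ZFSet.{u}) (hx : (x : Set ZFSet.{u}).Finite) : p x hx := by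
  obtain ⟨s, hs⟩ : ∃ s, (x : Set ZFSet.{u}) = s := ⟨_, rfl⟩
  induction s, hs ▸ hx using Set.Finite.induction_on generalizing x with
  | empty =>
    cases SetLike.coe_injective (hs.trans ZFSet.coe_empty.symm)
    exact empty
  | @insert a s _ hsfin ih =>
    obtain ⟨y, rfl⟩ : ∃ y : ZFSet.{u}, (y : Set ZFSet.{u}) = s := ⟨ZFSet.sep (· ∈ s) x, by
      rw [ZFSet.coe_sep]
      exact Set.inter_eq_right.2 (hs ▸ Set.subset_insert a s)⟩
    cases SetLike.coe_injective (hs.trans (ZFSet.coe_insert a y).symm)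
    exact insert a y hsfin (ih y hsfin rfl)

section TransitiveModel

variable {M : Set ZFSet.{u}} {n : ℕ} {T S : (Fin n → ZFSet.{u}) → ZFSet.{u}}

@[fun_prop]
theorem DefinableRel.exists_mem (hM : IsTransitiveModel M)
    {P : ZFSet.{u} → (Fin n → ZFSet.{u}) → Prop} (hT : DefinableOp M T)
    (hP : DefinableRel M fun w : Fin (n + 1) → ZFSet.{u} => P (w 0) fun i => w i.succ) :
    DefinableRel M fun v => ∃ z ∈ T v, P z v :=
  (DefinableRel.exists (P := fun z v => z ∈ T v ∧ P z v)
    ((DefinableRel.mem (.var 0) (hT.comp fun i => .var i.succ)).and hP)).congr fun _ hv =>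
    ⟨fun ⟨z, _, h⟩ => ⟨z, h⟩,
      fun ⟨z, h⟩ => ⟨z, hM.transitive _ (hT.apply_mem hv) _ h.1, h⟩⟩

@[fun_prop]
theorem DefinableRel.forall_mem (hM : IsTransitiveModel M)
    {P : ZFSet.{u} → (Fin n → ZFSet.{u}) → Prop} (hT : DefinableOp M T)
    (hP : DefinableRel M fun w : Fin (n + 1) → ZFSet.{u} => P (w 0) fun i => w i.succ) :
    DefinableRel M fun v => ∀ z ∈ T v, P z v :=
  (DefinableRel.exists_mem hM (P := fun z v => ¬ P z v) hT hP.not).not.congr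
    fun v _ => by push Not; rfl

theorem DefinableOp.of_mem (hM : IsTransitiveModel M) (hT : ∀ v, (∀ i, v i ∈ M) → T v ∈ M)
    (hmem : DefinableRel M fun w : Fin (n + 1) → ZFSet.{u} => w 0 ∈ T fun i => w i.succ) :
    DefinableOp M T := by
  refine ⟨fun v => ⟨_, hT (fun i => v i) fun i => (v i).2⟩, fun _ => rfl, ?_⟩
  have hmem' : DefinableRel M fun w : Fin (n + 2) → ZFSet.{u} => w 0 ∈ T fun i => w i.succ.succ :=
    hmem.comp (T := Fin.cons (fun w => w 0) fun i w => w i.succ.succ)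
      (Fin.cases (.var 0) fun i => .var i.succ.succ)
  have hgraph : DefinableRel M fun w : Fin (n + 1) → ZFSet.{u} =>
      ∀ z ∈ M, z ∈ w 0 ↔ z ∈ T fun i => w i.succ :=
    .forall ((DefinableRel.mem (.var 0) (.var 1)).iff hmem')
  change (Set.univ : Set M).Definable setLanguage (Function.tupleGraph _)
  convert! Set.Definable.preimage_comp (Fin.cases none some) hgraph using 1
  ext w
  constructor
  · intro h z _
    exact iff_of_eq (congrArg (fun x : M => z ∈ x.1) h.symm)
  · intro h
    refine Subtype.ext (ZFSet.ext fun z => ?_)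
    have hTM := hT (fun i => w (some i)) fun i => (w (some i)).2
    exact ⟨fun hz => (h z (hM.transitive _ hTM _ hz)).2 hz,
      fun hz => (h z (hM.transitive _ (w none).2 _ hz)).1 hz⟩

@[fun_prop]
theorem DefinableRel.subset (hM : IsTransitiveModel M) (hT : DefinableOp M T)
    (hS : DefinableOp M S) : DefinableRel M fun v => T v ⊆ S v :=
  forall_mem hM hT (.mem (.var 0) (hS.comp fun i => .var i.succ))

namespace IsTransitiveModel

theorem ext_coe (hM : IsTransitiveModel M) {x : ZFSet.{u}} (hx : ∀ z ∈ x, z ∈ M) {y : M}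
    (h : ∀ z : M, z.1 ∈ y.1 ↔ z.1 ∈ x) : y = x :=
  ZFSet.ext fun z =>
    ⟨fun hz => (h ⟨z, hM.transitive _ y.2 _ hz⟩).1 hz, fun hz => (h ⟨z, hx z hz⟩).2 hz⟩

theorem mem_of_forall_mem_iff (hM : IsTransitiveModel M) {x : ZFSet.{u}} (hx : ∀ z ∈ x, z ∈ M)
    {y : M} (h : ∀ z : M, z.1 ∈ y.1 ↔ z.1 ∈ x) : x ∈ M :=
  hM.ext_coe hx h ▸ y.2

theorem sep_mem (hM : IsTransitiveModel M) {P : ZFSet.{u} → Prop}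
    (hP : DefinableRel M fun v : Fin 1 → ZFSet.{u} => P (v 0)) {x : ZFSet.{u}} (hx : x ∈ M) :
    ZFSet.sep P x ∈ M := by
  obtain ⟨y, hy⟩ := hM.models.separation {z : M | P z.1} hP ⟨x, hx⟩
  exact hM.mem_of_forall_mem_iff (fun z hz => hM.transitive _ hx _ (ZFSet.mem_sep.1 hz).1)
    fun z => (hy z).trans ZFSet.mem_sep.symm

theorem pair_set_mem (hM : IsTransitiveModel M) {x y : ZFSet.{u}} (hx : x ∈ M) (hy : y ∈ M) :
    ({x, y} : ZFSet.{u}) ∈ M := by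
  obtain ⟨p, hp⟩ := hM.models.pairing ⟨x, hx⟩ ⟨y, hy⟩
  refine hM.mem_of_forall_mem_iff (fun z hz => ?_) fun z => (hp z).trans ?_
  · rcases ZFSet.mem_pair.1 hz with rfl | rfl <;> assumption
  · simp only [ZFSet.mem_pair, Subtype.ext_iff]

theorem singleton_mem (hM : IsTransitiveModel M) {x : ZFSet.{u}} (hx : x ∈ M) :
    ({x} : ZFSet.{u}) ∈ M := by
  simpa only [ZFSet.pair_eq_singleton] using hM.pair_set_mem hx hx

theorem pair_mem (hM : IsTransitiveModel M) {x y : ZFSet.{u}} (hx : x ∈ M) (hy : y ∈ M) :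
    ZFSet.pair x y ∈ M :=
  hM.pair_set_mem (hM.singleton_mem hx) (hM.pair_set_mem hx hy)

theorem mem_of_pair_mem (hM : IsTransitiveModel M) {x y : ZFSet.{u}} (h : ZFSet.pair x y ∈ M) :
    x ∈ M ∧ y ∈ M := by
  have hxy : ({x, y} : ZFSet.{u}) ∈ M := hM.transitive _ h _ (by simp [ZFSet.pair])
  exact ⟨hM.transitive _ hxy _ (by simp), hM.transitive _ hxy _ (by simp)⟩

theorem sUnion_mem (hM : IsTransitiveModel M) {x : ZFSet.{u}} (hx : x ∈ M) :
    (ZFSet.sUnion x) ∈ M := by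
  obtain ⟨s, hs⟩ := hM.models.union ⟨x, hx⟩
  refine hM.mem_of_forall_mem_iff (fun z hz => ?_) fun z => (hs z).trans ?_
  · obtain ⟨y, hy, hz⟩ := ZFSet.mem_sUnion.1 hz
    exact hM.transitive _ (hM.transitive _ hx _ hy) _ hz
  · exact ⟨fun ⟨y, hy, hz⟩ => ZFSet.mem_sUnion.2 ⟨y, hy, hz⟩, fun hz =>
      have ⟨y, hy, hz⟩ := ZFSet.mem_sUnion.1 hz
      ⟨⟨y, hM.transitive _ hx _ hy⟩, hy, hz⟩⟩

theorem union_mem (hM : IsTransitiveModel M) {x y : ZFSet.{u}} (hx : x ∈ M) (hy : y ∈ M) :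
    x ∪ y ∈ M :=
  hM.sUnion_mem (hM.pair_set_mem hx hy)

theorem insert_mem (hM : IsTransitiveModel M) {x y : ZFSet.{u}} (hx : x ∈ M) (hy : y ∈ M) :
    insert x y ∈ M := by
  rw [ZFSet.insert_eq]
  exact hM.union_mem (hM.singleton_mem hx) hy

theorem empty_mem (hM : IsTransitiveModel M) : (∅ : ZFSet.{u}) ∈ M := by
  obtain ⟨_, ⟨e, -, he⟩, -⟩ := hM.models.infinity
  exact hM.mem_of_forall_mem_iff (fun z hz => (ZFSet.notMem_empty z hz).elim)
    fun z => iff_of_false (he z) (ZFSet.notMem_empty _)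

theorem mem_of_finite (hM : IsTransitiveModel M) {x : ZFSet.{u}}
    (hx : (x : Set ZFSet.{u}).Finite) (h : ∀ y ∈ x, y ∈ M) : x ∈ M := by
  induction x, hx using finite_coe_induction with
  | empty => exact hM.empty_mem
  | insert a y _ ih =>
    simp only [ZFSet.mem_insert_iff, forall_eq_or_imp] at h
    exact hM.insert_mem h.1 (ih h.2)

theorem exists_powerset (hM : IsTransitiveModel M) {x : ZFSet.{u}} (hx : x ∈ M) :
    ∃ p ∈ M, ∀ y, y ∈ p ↔ y ∈ M ∧ y ⊆ x := by
  obtain ⟨⟨p, hp⟩, h⟩ := hM.models.powerset ⟨x, hx⟩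
  refine ⟨p, hp, fun y => ⟨fun hy => ?_, fun hy => ?_⟩⟩
  · have hyM := hM.transitive _ hp _ hy
    exact ⟨hyM, fun z hz => (h ⟨y, hyM⟩).1 hy ⟨z, hM.transitive _ hyM _ hz⟩ hz⟩
  · exact (h ⟨y, hy.1⟩).2 fun z hz => hy.2 hz

end IsTransitiveModel

@[fun_prop]
theorem DefinableOp.insert (hM : IsTransitiveModel M) (hT : DefinableOp M T)
    (hS : DefinableOp M S) : DefinableOp M fun v => insert (T v) (S v) :=
  .of_mem hM (fun _ hv => hM.insert_mem (hT.apply_mem hv) (hS.apply_mem hv)) <| by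
    simp only [ZFSet.mem_insert_iff]
    exact .or (.eq (.var 0) (hT.comp fun i => .var i.succ))
      (.mem (.var 0) (hS.comp fun i => .var i.succ))

@[fun_prop]
theorem DefinableOp.singleton (hM : IsTransitiveModel M) (hT : DefinableOp M T) :
    DefinableOp M fun v => ({T v} : ZFSet.{u}) := by
  simpa only [LawfulSingleton.insert_empty_eq] using hT.insert hM (.const hM.empty_mem)

@[fun_prop]
theorem DefinableOp.pair (hM : IsTransitiveModel M) (hT : DefinableOp M T)
    (hS : DefinableOp M S) : DefinableOp M fun v => ZFSet.pair (T v) (S v) :=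
  (hT.singleton hM).insert hM ((hT.insert hM (hS.singleton hM)).singleton hM)

@[fun_prop]
theorem DefinableOp.union (hM : IsTransitiveModel M) (hT : DefinableOp M T)
    (hS : DefinableOp M S) : DefinableOp M fun v => T v ∪ S v :=
  .of_mem hM (fun _ hv => hM.union_mem (hT.apply_mem hv) (hS.apply_mem hv)) <| by
    simp only [ZFSet.mem_union]
    exact .or (.mem (.var 0) (hT.comp fun i => .var i.succ))
      (.mem (.var 0) (hS.comp fun i => .var i.succ))

@[fun_prop]
theorem DefinableOp.sep (hM : IsTransitiveModel M) {P : ZFSet.{u} → (Fin n → ZFSet.{u}) → Prop}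
    (hP : DefinableRel M fun w : Fin (n + 1) → ZFSet.{u} => P (w 0) fun i => w i.succ)
    (hT : DefinableOp M T) : DefinableOp M fun v => ZFSet.sep (fun z => P z v) (T v) :=
  .of_mem hM (fun v hv => hM.sep_mem
      (hP.comp (T := Fin.cons (fun w => w 0) fun i _ => v i)
        (Fin.cases (.var 0) fun i => .const (hv i))) (hT.apply_mem hv)) <| by
    simp only [ZFSet.mem_sep]
    exact .and (.mem (.var 0) (hT.comp fun i => .var i.succ)) hP

@[fun_prop]
theorem DefinableOp.sUnion (hM : IsTransitiveModel M) (hT : DefinableOp M T) :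
    DefinableOp M fun v => ZFSet.sUnion (T v) :=
  .of_mem hM (fun _ hv => hM.sUnion_mem (hT.apply_mem hv)) <| by
    simp only [ZFSet.mem_sUnion]
    exact .exists_mem hM (hT.comp fun i => .var i.succ) (.mem (.var 1) (.var 0))

end TransitiveModel

/-! ### Numerals -/

section Numerals

theorem mem_numeral {x : ZFSet.{u}} {n : ℕ} : x ∈ numeral n ↔ ∃ m < n, x = numeral m := by
  induction n with
  | zero => simp [numeral]
  | succ n ih =>
    simp only [numeral, ZFSet.mem_insert_iff, ih, Nat.lt_succ_iff_lt_or_eq, or_and_right,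
      exists_or, exists_eq_left, or_comm]

theorem numeral_injective : Function.Injective numeral.{u} :=
  .of_lt_imp_ne fun _ n hmn h => ZFSet.mem_irrefl (numeral n) (mem_numeral.2 ⟨_, hmn, h.symm⟩)

theorem numeral_mem_numeral {m n : ℕ} : numeral.{u} m ∈ numeral n ↔ m < n := by
  simp only [mem_numeral, numeral_injective.eq_iff, exists_eq_right']

theorem mem_omega_iff {x : ZFSet.{u}} : x ∈ ZFSet.omega ↔ ∃ n, x = numeral n := by
  have hmk : ∀ n, numeral.{u} n = ZFSet.mk (PSet.ofNat n) := by
    intro n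
    induction n with
    | zero => rfl
    | succ n ih => rw [numeral, ih]; rfl
  constructor
  · refine Quotient.inductionOn x fun x hx => ?_
    obtain ⟨⟨n⟩, hn⟩ := hx
    exact ⟨n, (ZFSet.sound hn).trans (hmk n).symm⟩
  · rintro ⟨n, rfl⟩
    induction n with
    | zero => exact ZFSet.omega_zero
    | succ n ih => exact ZFSet.omega_succ ih

theorem exists_mem_omega {p : ZFSet.{u} → Prop} :
    (∃ k ∈ ZFSet.omega, p k) ↔ ∃ n, p (numeral n) := by
  simp only [mem_omega_iff, ← exists_and_right, exists_comm (α := ZFSet.{u}), exists_eq_left]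

theorem forall_mem_omega {p : ZFSet.{u} → Prop} :
    (∀ k ∈ ZFSet.omega, p k) ↔ ∀ n, p (numeral n) := by
  simp only [mem_omega_iff, forall_exists_index, forall_eq_apply_imp_iff]

theorem numeral_mem_omega (n : ℕ) : numeral.{u} n ∈ ZFSet.omega :=
  mem_omega_iff.2 ⟨n, rfl⟩

theorem mem_omega_iff_forall_mem_insert {x : ZFSet.{u}} :
    x ∈ ZFSet.omega ↔ ∀ z ∈ insert x x, z = ∅ ∨ ∃ y ∈ z, z = insert y y := by
  rw [mem_omega_iff]
  constructor
  · rintro ⟨n, rfl⟩ z hz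
    obtain ⟨m, -, rfl⟩ := mem_numeral.1 (show z ∈ numeral (n + 1) from hz)
    cases m with
    | zero => exact .inl rfl
    | succ m => exact .inr ⟨numeral m, ZFSet.mem_insert _ _, rfl⟩
  · induction x using ZFSet.inductionOn with
    | _ x ih =>
    intro h
    obtain rfl | ⟨y, hy, rfl⟩ := h x (ZFSet.mem_insert _ _)
    · exact ⟨0, rfl⟩
    · obtain ⟨n, rfl⟩ := ih y hy fun z hz => h z (ZFSet.mem_insert_of_mem _ hz)
      exact ⟨n + 1, rfl⟩

end Numerals

section Closure

variable {M : Set ZFSet.{u}}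

namespace IsTransitiveModel

theorem numeral_mem (hM : IsTransitiveModel M) (n : ℕ) : numeral n ∈ M := by
  induction n with
  | zero => exact hM.empty_mem
  | succ n ih => exact hM.insert_mem ih ih

theorem two_mem (hM : IsTransitiveModel M) : ({numeral 0, numeral 1} : ZFSet.{u}) ∈ M :=
  hM.pair_set_mem (hM.numeral_mem 0) (hM.numeral_mem 1)

theorem omega_mem (hM : IsTransitiveModel M) : ZFSet.omega ∈ M := by
  obtain ⟨I, ⟨e, heI, he⟩, hsucc⟩ := hM.models.infinity
  have hI : ∀ n, numeral n ∈ I.1 := by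
    intro n
    induction n with
    | zero =>
      rwa [numeral, ← hM.ext_coe (y := e) (x := ∅) (by simp) fun z =>
        iff_of_false (he z) (ZFSet.notMem_empty _)]
    | succ n ih =>
      have hn := hM.numeral_mem n
      obtain ⟨s, hsI, hs⟩ := hsucc ⟨_, hn⟩ ih
      rwa [← hM.ext_coe (y := s) (hM.transitive _ (hM.numeral_mem (n + 1))) fun z => ?_]
      rw [hs, numeral, ZFSet.mem_insert_iff, or_comm, Subtype.ext_iff]
  have hsep : ZFSet.sep (fun x => ∀ z ∈ insert x x, z = ∅ ∨ ∃ y ∈ z, z = insert y y) I ∈ M :=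
    have := hM.empty_mem
    hM.sep_mem (by fun_prop (disch := assumption)) I.2
  convert! hsep using 1
  ext z
  rw [ZFSet.mem_sep, ← mem_omega_iff_forall_mem_insert, iff_and_self, mem_omega_iff]
  rintro ⟨n, rfl⟩
  exact hI n

theorem prod_mem (hM : IsTransitiveModel M) {x y : ZFSet.{u}} (hx : x ∈ M) (hy : y ∈ M) :
    ZFSet.prod x y ∈ M := by
  obtain ⟨p, hp, hpm⟩ := hM.exists_powerset (hM.union_mem hx hy)
  obtain ⟨q, hq, hqm⟩ := hM.exists_powerset hp
  have hsep : ZFSet.sep (fun z => ∃ a ∈ x, ∃ b ∈ y, z = ZFSet.pair a b) q ∈ M :=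
    hM.sep_mem (by fun_prop (disch := assumption)) hq
  convert! hsep using 1
  ext z
  rw [ZFSet.mem_prod, ZFSet.mem_sep, iff_and_self]
  rintro ⟨a, ha, b, hb, rfl⟩
  have haM := hM.transitive _ hx _ ha
  have hbM := hM.transitive _ hy _ hb
  refine (hqm _).2 ⟨hM.pair_mem haM hbM, fun w hw => (hpm _).2 ?_⟩
  rcases ZFSet.mem_pair.1 hw with rfl | rfl
  · exact ⟨hM.singleton_mem haM, by simp [ZFSet.subset_def, ha]⟩
  · exact ⟨hM.pair_set_mem haM hbM, by simp [ZFSet.subset_def, ha, hb]⟩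

end IsTransitiveModel

end Closure

/-! ### Iteration of definable operations -/

section Iteration

variable {M : Set ZFSet.{u}} {F : ZFSet.{u} → ZFSet.{u}} {X x₀ s : ZFSet.{u}}

/-- Every element of `s` is either `(0, x₀)` or of the form `(k + 1, F y)` with `(k, y) ∈ s`, so
that `s` is part of the graph of `n ↦ F^[n] x₀`. -/
def IsIterateApprox (F : ZFSet.{u} → ZFSet.{u}) (X x₀ s : ZFSet.{u}) : Prop :=
  ∀ p ∈ s, p = ZFSet.pair ∅ x₀ ∨ ∃ k ∈ ZFSet.omega, ∃ y ∈ X,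
    ZFSet.pair k y ∈ s ∧ p = ZFSet.pair (insert k k) (F y)

theorem IsIterateApprox.eq_iterate (hs : IsIterateApprox F X x₀ s) {n : ℕ} {x : ZFSet.{u}}
    (h : ZFSet.pair (numeral n) x ∈ s) : x = F^[n] x₀ := by
  induction n generalizing x with
  | zero =>
    obtain h | ⟨k, -, y, -, -, h⟩ := hs _ h
    · exact (ZFSet.pair_inj.1 h).2
    · exact absurd (ZFSet.mem_insert k k) ((ZFSet.pair_inj.1 h).1 ▸ ZFSet.notMem_empty k)
  | succ n ih =>
    obtain h | ⟨k, hk, y, -, hy, h⟩ := hs _ h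
    · exact absurd (ZFSet.mem_insert (numeral n) _) ((ZFSet.pair_inj.1 h).1 ▸ ZFSet.notMem_empty _)
    · obtain ⟨m, rfl⟩ := mem_omega_iff.1 hk
      obtain ⟨hnm, rfl⟩ := ZFSet.pair_inj.1 h
      cases numeral_injective (a₁ := n + 1) (a₂ := m + 1) hnm
      rw [ih hy, Function.iterate_succ_apply']

namespace IsTransitiveModel

theorem exists_isIterateApprox (hM : IsTransitiveModel M) (hX : X ∈ M) (hx₀ : x₀ ∈ X)
    (hF : Set.MapsTo F X X) (n : ℕ) :
    ∃ s ∈ M, s ⊆ ZFSet.prod ZFSet.omega X ∧ IsIterateApprox F X x₀ s ∧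
      ZFSet.pair (numeral n) (F^[n] x₀) ∈ s := by
  have hprod (k : ℕ) : ZFSet.pair (numeral k) (F^[k] x₀) ∈ ZFSet.prod ZFSet.omega X :=
    ZFSet.pair_mem_prod.2 ⟨numeral_mem_omega k, hF.iterate k hx₀⟩
  have hpairM (k : ℕ) : ZFSet.pair (numeral k) (F^[k] x₀) ∈ M :=
    hM.transitive _ (hM.prod_mem hM.omega_mem hX) _ (hprod k)
  induction n with
  | zero =>
    refine ⟨_, hM.singleton_mem (hpairM 0), fun p hp => ?_, fun p hp => ?_, by simp⟩
    · exact ZFSet.mem_singleton.1 hp ▸ hprod 0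
    · exact .inl (ZFSet.mem_singleton.1 hp)
  | succ n ih =>
    obtain ⟨s, hsM, hsub, hs, hn⟩ := ih
    refine ⟨_, hM.insert_mem (hpairM (n + 1)) hsM, fun p hp => ?_, fun p hp => ?_,
      ZFSet.mem_insert _ _⟩ <;> obtain rfl | hp := ZFSet.mem_insert_iff.1 hp
    · exact hprod _
    · exact hsub hp
    · exact .inr ⟨_, numeral_mem_omega n, _, hF.iterate n hx₀, ZFSet.mem_insert_of_mem _ hn,
        by rw [Function.iterate_succ_apply', numeral]⟩
    · exact (hs p hp).imp_right fun ⟨k, hk, y, hy, h, hpy⟩ =>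
        ⟨k, hk, y, hy, ZFSet.mem_insert_of_mem _ h, hpy⟩

theorem exists_iterate_graph (hM : IsTransitiveModel M) (hX : X ∈ M) (hx₀ : x₀ ∈ X)
    (hF : Set.MapsTo F X X) (hdef : DefinableOp M fun v : Fin 1 → ZFSet.{u} => F (v 0)) :
    ∃ G ∈ M, ∀ n x, ZFSet.pair (numeral n) x ∈ G ↔ x = F^[n] x₀ := by
  have hω := hM.omega_mem
  have hzero : ZFSet.pair ∅ x₀ ∈ M := hM.pair_mem hM.empty_mem (hM.transitive _ hX _ hx₀)
  have hprod := hM.prod_mem hω hX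
  obtain ⟨Q, hQM, hQ⟩ := hM.exists_powerset hprod
  refine ⟨ZFSet.sep (fun p => ∃ s ∈ Q, IsIterateApprox F X x₀ s ∧ p ∈ s)
    (ZFSet.prod ZFSet.omega X), hM.sep_mem ?_ hprod, fun n x => ?_⟩
  · refine .exists_mem hM (.const hQM) (.and (.forall_mem hM (.var 0) (.or ?_
      (.exists_mem hM (.const hω) (.exists_mem hM (.const hX) (.and ?_
        (.eq (.var 2) (.pair hM ?_ (hdef.comp fun _ => .var 0)))))))) ?_) <;>
      fun_prop (disch := assumption)
  · rw [ZFSet.mem_sep]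
    constructor
    · rintro ⟨-, s, -, hs, hn⟩
      exact hs.eq_iterate hn
    · rintro rfl
      obtain ⟨s, hsM, hsub, hs, hn⟩ := hM.exists_isIterateApprox hX hx₀ hF n
      exact ⟨hsub hn, s, (hQ s).2 ⟨hsM, hsub⟩, hs, hn⟩

theorem exists_mem_iterate_graph (hM : IsTransitiveModel M) (hX : X ∈ M) (hx₀ : x₀ ∈ X)
    (hF : Set.MapsTo F X X) (hdef : DefinableOp M fun v : Fin 1 → ZFSet.{u} => F (v 0)) :
    ∃ R ∈ M, ∀ n t, ZFSet.pair (numeral n) t ∈ R ↔ t ∈ F^[n] x₀ := by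
  have hω := hM.omega_mem
  have hU := hM.sUnion_mem hX
  obtain ⟨G, hGM, hG⟩ := hM.exists_iterate_graph hX hx₀ hF hdef
  refine ⟨ZFSet.sep (fun p => ∃ k ∈ ZFSet.omega, ∃ Y ∈ X, ZFSet.pair k Y ∈ G ∧
    ∃ t ∈ Y, p = ZFSet.pair k t) (ZFSet.prod ZFSet.omega (ZFSet.sUnion X)),
    hM.sep_mem (by fun_prop (disch := assumption)) (hM.prod_mem hω hU), fun n t => ?_⟩
  rw [ZFSet.mem_sep]
  constructor
  · rintro ⟨-, k, -, Y, -, hkY, t', ht', hpair⟩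
    obtain ⟨rfl, rfl⟩ := ZFSet.pair_inj.1 hpair
    exact (hG n Y).1 hkY ▸ ht'
  · intro ht
    have hmem : F^[n] x₀ ∈ X := hF.iterate n hx₀
    exact ⟨ZFSet.pair_mem_prod.2 ⟨numeral_mem_omega n, ZFSet.mem_sUnion.2 ⟨_, hmem, ht⟩⟩,
      _, numeral_mem_omega n, _, hmem, (hG n _).2 rfl, t, ht, rfl⟩

theorem exists_iUnion_iterate (hM : IsTransitiveModel M) (hX : X ∈ M) (hx₀ : x₀ ∈ X)
    (hF : Set.MapsTo F X X) (hdef : DefinableOp M fun v : Fin 1 → ZFSet.{u} => F (v 0)) :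
    ∃ U ∈ M, ∀ t, t ∈ U ↔ ∃ n, t ∈ F^[n] x₀ := by
  have hω := hM.omega_mem
  obtain ⟨R, hRM, hR⟩ := hM.exists_mem_iterate_graph hX hx₀ hF hdef
  refine ⟨ZFSet.sep (fun t => ∃ k ∈ ZFSet.omega, ZFSet.pair k t ∈ R) (ZFSet.sUnion X),
    hM.sep_mem (by fun_prop (disch := assumption)) (hM.sUnion_mem hX), fun t => ?_⟩
  simp only [ZFSet.mem_sep, exists_mem_omega, hR, and_iff_right_iff_imp]
  rintro ⟨n, hn⟩
  exact ZFSet.mem_sUnion.2 ⟨_, hF.iterate n hx₀, hn⟩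

end IsTransitiveModel

end Iteration

/-! ### Finite subsets -/

section FiniteSubsets

variable {M : Set ZFSet.{u}}

namespace IsTransitiveModel

theorem exists_finite_subsets (hM : IsTransitiveModel M) {x : ZFSet.{u}} (hx : x ∈ M) :
    ∃ K ∈ M, ∀ t, t ∈ K ↔ t ⊆ x ∧ (t : Set ZFSet.{u}).Finite := by
  obtain ⟨P, hPM, hP⟩ := hM.exists_powerset hx
  obtain ⟨Q, hQM, hQ⟩ := hM.exists_powerset hPM
  set F : ZFSet.{u} → ZFSet.{u} :=
    fun Y => Y ∪ ZFSet.sep (fun t => ∃ y ∈ Y, ∃ a ∈ x, t = insert a y) P with hF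
  have hFdef : DefinableOp M fun v : Fin 1 → ZFSet.{u} => F (v 0) := by
    simp only [hF]
    fun_prop (disch := assumption)
  have hFQ : Set.MapsTo F Q Q := fun Y hY => (hQ _).2
    ⟨hFdef.apply_mem (v := fun _ => Y) fun _ => hM.transitive _ hQM _ hY, fun t ht =>
      (ZFSet.mem_union.1 ht).elim (fun h => ((hQ Y).1 hY).2 h) fun h => (ZFSet.mem_sep.1 h).1⟩
  have hempty : {∅} ∈ Q := (hQ _).2 ⟨hM.singleton_mem hM.empty_mem, by
    simp [ZFSet.subset_def, hP, hM.empty_mem]⟩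
  have hmem_succ (n : ℕ) (t : ZFSet.{u}) : t ∈ F^[n + 1] {∅} ↔
      t ∈ F^[n] {∅} ∨ t ∈ P ∧ ∃ y ∈ F^[n] {∅}, ∃ a ∈ x, t = insert a y := by
    rw [Function.iterate_succ_apply', hF, ZFSet.mem_union, ZFSet.mem_sep]
  obtain ⟨K, hKM, hK⟩ := hM.exists_iUnion_iterate hQM hempty hFQ hFdef
  refine ⟨K, hKM, fun t => (hK t).trans ⟨?_, ?_⟩⟩
  · rintro ⟨n, hn⟩
    refine ⟨((hP t).1 (((hQ _).1 (hFQ.iterate n hempty)).2 hn)).2, ?_⟩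
    induction n generalizing t with
    | zero => simp [ZFSet.mem_singleton.1 hn]
    | succ n ih =>
      obtain hn | ⟨-, y, hy, a, -, rfl⟩ := (hmem_succ n t).1 hn
      · exact ih t hn
      · simpa using (ih y hy).insert a
  · rintro ⟨htx, ht⟩
    induction t, ht using finite_coe_induction with
    | empty => exact ⟨0, ZFSet.mem_singleton.2 rfl⟩
    | insert a y hy ih =>
      obtain ⟨n, hn⟩ := ih fun z hz => htx (ZFSet.mem_insert_of_mem _ hz)
      have haM : insert a y ∈ M := hM.mem_of_finite (by simpa using hy.insert a)
        fun z hz => hM.transitive _ hx _ (htx hz)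
      exact ⟨n + 1, (hmem_succ n _).2 <| .inr
        ⟨(hP _).2 ⟨haM, htx⟩, y, hn, a, htx (ZFSet.mem_insert _ _), rfl⟩⟩

end IsTransitiveModel

end FiniteSubsets

/-! ### Cohen conditions -/

section CohenPoset

variable {M : Set ZFSet.{u}} {X Y h g : ZFSet.{u}}

/-- The domain of a Cohen condition `h`, a set of ordered pairs. -/
def condDom (h : ZFSet.{u}) : Set ZFSet.{u} :=
  {a | ∃ i, ZFSet.pair a i ∈ h}

theorem condDom_finite (hh : (h : Set ZFSet.{u}).Finite) : (condDom h).Finite := by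
  have hinj : Function.Injective fun q : ZFSet.{u} × ZFSet.{u} => ZFSet.pair q.1 q.2 :=
    fun _ _ hpq => Prod.ext_iff.2 (ZFSet.pair_inj.1 hpq)
  refine ((hh.preimage hinj.injOn).image Prod.fst).subset ?_
  rintro a ⟨i, hi⟩
  exact ⟨(a, i), hi, rfl⟩

namespace IsCohen

theorem mem_of_pair_mem (hh : IsCohen X h) {a i : ZFSet.{u}} (hai : ZFSet.pair a i ∈ h) :
    a ∈ X ∧ i ∈ ({numeral 0, numeral 1} : ZFSet.{u}) :=
  ZFSet.pair_mem_prod.1 (hh.1 hai)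

theorem subset_iff (hh : IsCohen X h) :
    h ⊆ g ↔ ∀ a i, ZFSet.pair a i ∈ h → ZFSet.pair a i ∈ g := by
  refine ⟨fun hhg _ _ hai => hhg hai, fun hhg p hp => ?_⟩
  obtain ⟨a, -, i, -, rfl⟩ := ZFSet.mem_prod.1 (hh.1 hp)
  exact hhg a i hp

theorem of_condDom_subset (hh : IsCohen X h) (hY : ∀ a ∈ condDom h, a ∈ Y) : IsCohen Y h :=
  ⟨hh.subset_iff.2 fun a i hai =>
    ZFSet.pair_mem_prod.2 ⟨hY a ⟨i, hai⟩, (hh.mem_of_pair_mem hai).2⟩, hh.2⟩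

theorem mono (hh : IsCohen X h) (hXY : X ⊆ Y) : IsCohen Y h :=
  hh.of_condDom_subset fun _ ⟨_, hai⟩ => hXY (hh.mem_of_pair_mem hai).1

theorem union (hh : IsCohen X h) (hg : IsCohen X g)
    (hcompat : ∀ x i j, ZFSet.pair x i ∈ h → ZFSet.pair x j ∈ g → i = j) : IsCohen X (h ∪ g) := by
  refine ⟨fun p hp => (ZFSet.mem_union.1 hp).elim (fun hp => hh.1 hp) fun hp => hg.1 hp,
    (hh.2.1.union hg.2.1).subset fun p hp => ZFSet.mem_union.1 hp, fun x i j hi hj => ?_⟩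
  rcases ZFSet.mem_union.1 hi with hi | hi <;> rcases ZFSet.mem_union.1 hj with hj | hj
  exacts [hh.2.2 x i j hi hj, hcompat x i j hi hj, (hcompat x j i hj hi).symm, hg.2.2 x i j hi hj]

theorem mem (hM : IsTransitiveModel M) (hX : X ∈ M) (hh : IsCohen X h) : h ∈ M :=
  hM.mem_of_finite hh.2.1 fun _ hp => hM.transitive _ (hM.prod_mem hX hM.two_mem) _ (hh.1 hp)

end IsCohen

theorem finite_setOf_isCohen_condDom_subset {s : Set ZFSet.{u}} (hs : s.Finite) :
    {h | IsCohen X h ∧ condDom h ⊆ s}.Finite := by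
  have hfin : (Set.image2 ZFSet.pair s {numeral 0, numeral 1}).Finite :=
    hs.image2 _ (Set.toFinite _)
  refine (hfin.finite_subsets.preimage SetLike.coe_injective.injOn).subset ?_
  rintro h ⟨hh, hhs⟩ p hp
  obtain ⟨a, -, i, hi, rfl⟩ := ZFSet.mem_prod.1 (hh.1 hp)
  exact ⟨a, hhs ⟨i, hp⟩, i, ZFSet.mem_pair.1 hi, rfl⟩

namespace IsTransitiveModel

theorem exists_cohen (hM : IsTransitiveModel M) (hX : X ∈ M) :
    ∃ p ∈ M, ∀ h, h ∈ p ↔ IsCohen X h := by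
  have h2 := hM.two_mem
  obtain ⟨K, hKM, hK⟩ := hM.exists_finite_subsets (hM.prod_mem hX h2)
  refine ⟨ZFSet.sep (fun h => ∀ x ∈ X, ∀ i ∈ ({numeral 0, numeral 1} : ZFSet.{u}),
    ∀ j ∈ ({numeral 0, numeral 1} : ZFSet.{u}),
      ZFSet.pair x i ∈ h → ZFSet.pair x j ∈ h → i = j) K,
    hM.sep_mem (by fun_prop (disch := assumption)) hKM, fun h => ?_⟩
  rw [ZFSet.mem_sep, hK, and_assoc]
  refine and_congr_right fun hsub => and_congr_right fun _ =>
    ⟨fun hfun x i j hi hj => ?_, fun hfun x _ i _ j _ => hfun x i j⟩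
  obtain ⟨hx, hi2⟩ := ZFSet.pair_mem_prod.1 (hsub hi)
  exact hfun x hx i hi2 j (ZFSet.pair_mem_prod.1 (hsub hj)).2 hi hj

theorem exists_cohen_sep (hM : IsTransitiveModel M) (hX : X ∈ M) {P : ZFSet.{u} → Prop}
    (hP : DefinableRel M fun v : Fin 1 → ZFSet.{u} => P (v 0)) :
    ∃ D ∈ M, ∀ h, h ∈ D ↔ IsCohen X h ∧ P h := by
  obtain ⟨p, hp, hpm⟩ := hM.exists_cohen hX
  exact ⟨_, hM.sep_mem hP hp, fun h => by rw [ZFSet.mem_sep, hpm]⟩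

end IsTransitiveModel

end CohenPoset

section Choice

variable {M : Set ZFSet.{u}} {X Y : ZFSet.{u}}

namespace IsTransitiveModel

theorem exists_image (hM : IsTransitiveModel M) (hX : X ∈ M) {F : ZFSet.{u} → ZFSet.{u}}
    (hF : DefinableOp M fun v : Fin 1 → ZFSet.{u} => F (v 0)) :
    ∃ Y ∈ M, ∀ y, y ∈ Y ↔ ∃ x ∈ X, y = F x := by
  have hgraph : DefinableRel M fun v : Fin 2 → ZFSet.{u} => v 1 = F (v 0) :=
    .eq (.var 1) (hF.comp fun _ => .var 0)
  obtain ⟨⟨Y, hYM⟩, hY⟩ := hM.models.replacement {p : M × M | p.2.1 = F p.1} hgraph ⟨X, hX⟩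
    fun x _ y y' hy hy' => Subtype.ext (hy.trans hy'.symm)
  refine ⟨Y, hYM, fun y => ⟨fun hy => ?_, ?_⟩⟩
  · obtain ⟨x, hx, hxy⟩ := (hY ⟨y, hM.transitive _ hYM _ hy⟩).1 hy
    exact ⟨x, hx, hxy⟩
  · rintro ⟨x, hx, rfl⟩
    have hxM := hM.transitive _ hX _ hx
    exact (hY ⟨F x, hF.apply_mem (v := fun _ => x) fun _ => hxM⟩).2 ⟨⟨x, hxM⟩, hx, rfl⟩

theorem exists_transversal (hM : IsTransitiveModel M) (hX : X ∈ M) (hne : ∀ p ∈ X, ∃ z, z ∈ p)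
    (hdisj : ∀ p ∈ X, ∀ p' ∈ X, ∀ z, z ∈ p → z ∈ p' → p = p') :
    ∃ c ∈ M, ∀ p ∈ X, ∃! z, z ∈ p ∧ z ∈ c := by
  obtain ⟨c, hc⟩ := hM.models.choice ⟨X, hX⟩
    (fun p hp => have ⟨z, hz⟩ := hne p hp
      ⟨⟨z, hM.transitive _ p.2 _ hz⟩, hz⟩)
    fun p p' hp hp' ⟨z, hz, hz'⟩ => Subtype.ext (hdisj p hp p' hp' z hz hz')
  refine ⟨c, c.2, fun p hp => ?_⟩
  obtain ⟨z, hz, huniq⟩ := hc ⟨p, hM.transitive _ hX _ hp⟩ hp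
  exact ⟨z, hz, fun z' hz' =>
    congrArg Subtype.val (huniq ⟨z', hM.transitive _ c.2 _ hz'.2⟩ hz')⟩

theorem exists_choice (hM : IsTransitiveModel M) (hX : X ∈ M) (hY : Y ∈ M)
    {r : ZFSet.{u} → ZFSet.{u} → Prop}
    (hr : DefinableRel M fun v : Fin 2 → ZFSet.{u} => r (v 0) (v 1)) (h : ∀ x ∈ X, ∃ y ∈ Y, r x y) :
    ∃ c ∈ M, ∀ x ∈ X, ∃! y, y ∈ Y ∧ r x y ∧ ZFSet.pair x y ∈ c := by
  have hXY := hM.prod_mem hX hY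
  set fibre := fun x => ZFSet.sep (fun z => ∃ y ∈ Y, r x y ∧ z = ZFSet.pair x y) (ZFSet.prod X Y)
    with hfibre
  have mem_fibre {x : ZFSet.{u}} (hx : x ∈ X) (z : ZFSet.{u}) :
      z ∈ fibre x ↔ ∃ y ∈ Y, r x y ∧ z = ZFSet.pair x y := by
    rw [hfibre, ZFSet.mem_sep, and_iff_right_iff_imp]
    rintro ⟨y, hy, -, rfl⟩
    exact ZFSet.pair_mem_prod.2 ⟨hx, hy⟩
  have hdef : DefinableOp M fun v : Fin 1 → ZFSet.{u} => fibre (v 0) :=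
    .sep hM (.exists_mem hM (.const hY) (.and (hr.comp (T := ![fun w => w 2, fun w => w 0])
      (Fin.forall_fin_two.2 ⟨.var 2, .var 0⟩)) (.eq (.var 1) (.pair hM (.var 2) (.var 0)))))
      (.const hXY)
  obtain ⟨F, hFM, hF⟩ := hM.exists_image hX hdef
  have hne (p) (hp : p ∈ F) : ∃ z, z ∈ p := by
    obtain ⟨x, hx, rfl⟩ := (hF p).1 hp
    obtain ⟨y, hy, hxy⟩ := h x hx
    exact ⟨_, (mem_fibre hx _).2 ⟨y, hy, hxy, rfl⟩⟩
  have hdisj (p) (hp : p ∈ F) (p') (hp' : p' ∈ F) (z) (hz : z ∈ p) (hz' : z ∈ p') : p = p' := by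
    obtain ⟨x, hx, rfl⟩ := (hF p).1 hp
    obtain ⟨x', hx', rfl⟩ := (hF p').1 hp'
    obtain ⟨y, -, -, rfl⟩ := (mem_fibre hx z).1 hz
    obtain ⟨y', -, -, hxx'⟩ := (mem_fibre hx' _).1 hz'
    rw [(ZFSet.pair_inj.1 hxx').1]
  obtain ⟨c, hc, hcF⟩ := hM.exists_transversal hFM hne hdisj
  refine ⟨c, hc, fun x hx => ?_⟩
  obtain ⟨z, ⟨hz, hzc⟩, huniq⟩ := hcF (fibre x) ((hF _).2 ⟨x, hx, rfl⟩)
  obtain ⟨y, hy, hxy, rfl⟩ := (mem_fibre hx z).1 hz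
  refine ⟨y, ⟨hy, hxy, hzc⟩, fun y' ⟨hy', hxy', hyc'⟩ => ?_⟩
  exact (ZFSet.pair_inj.1 (huniq _ ⟨(mem_fibre hx _).2 ⟨y', hy', hxy', rfl⟩, hyc'⟩)).2

theorem exists_choice_function (hM : IsTransitiveModel M) (hX : X ∈ M) (hY : Y ∈ M)
    {r : ZFSet.{u} → ZFSet.{u} → Prop}
    (hr : DefinableRel M fun v : Fin 2 → ZFSet.{u} => r (v 0) (v 1)) (h : ∀ x ∈ X, ∃ y ∈ Y, r x y) :
    ∃ G : ZFSet.{u} → ZFSet.{u}, DefinableOp M (fun v : Fin 1 → ZFSet.{u} => G (v 0)) ∧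
      ∀ x ∈ X, G x ∈ Y ∧ r x (G x) := by
  obtain ⟨c, hcM, hc⟩ := hM.exists_choice hX hY hr h
  refine ⟨fun x => ZFSet.sUnion (ZFSet.sep (fun y => r x y ∧ ZFSet.pair x y ∈ c) Y),
    .sUnion hM (.sep hM (.and (hr.comp (T := ![fun w => w 1, fun w => w 0])
      (Fin.forall_fin_two.2 ⟨.var 1, .var 0⟩)) (.mem (.pair hM (.var 1) (.var 0)) (.const hcM)))
      (.const hY)), fun x hx => ?_⟩
  obtain ⟨y, ⟨hyY, hxy, hyc⟩, huniq⟩ := hc x hx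
  have hsing : ZFSet.sep (fun y => r x y ∧ ZFSet.pair x y ∈ c) Y = {y} :=
    ZFSet.ext fun z => by
      rw [ZFSet.mem_sep, ZFSet.mem_singleton]
      exact ⟨huniq z, fun hz => hz ▸ ⟨hyY, hxy, hyc⟩⟩
  simp only [hsing, ZFSet.sUnion_singleton]
  exact ⟨hyY, hxy⟩

end IsTransitiveModel

end Choice

/-! ### Countability in a transitive model -/

section LevelRank

variable {α : Type*} {lev : ℕ → Set α} {a b : α}

/-- The first level of the sequence of sets `lev` that contains `a` (`0` if there is none). -/
noncomputable def levelRank (lev : ℕ → Set α) (a : α) : ℕ :=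
  sInf {n | a ∈ lev n}

theorem levelRank_le_iff (hmono : Monotone lev) (ha : ∃ n, a ∈ lev n) {n : ℕ} :
    levelRank lev a ≤ n ↔ a ∈ lev n :=
  ⟨fun h => hmono h (Nat.sInf_mem ha), fun h => Nat.sInf_le h⟩

theorem levelRank_lt_iff (hmono : Monotone lev) (ha : ∃ n, a ∈ lev n) (hb : ∃ n, b ∈ lev n) :
    levelRank lev a < levelRank lev b ↔ ∃ n, a ∈ lev n ∧ b ∉ lev n := by
  simp only [← levelRank_le_iff hmono ha, ← levelRank_le_iff hmono hb, not_le]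
  exact ⟨fun h => ⟨_, le_rfl, h⟩, fun ⟨_, han, hnb⟩ => han.trans_lt hnb⟩

theorem levelRank_eq_iff (hmono : Monotone lev) (ha : ∃ n, a ∈ lev n) (hb : ∃ n, b ∈ lev n) :
    levelRank lev a = levelRank lev b ↔ ∀ n, a ∈ lev n ↔ b ∈ lev n := by
  simp only [← levelRank_le_iff hmono ha, ← levelRank_le_iff hmono hb]
  exact ⟨fun h n => by rw [h], eq_of_forall_ge_iff⟩

theorem exists_subset_level (hmono : Monotone lev) {s : Set α} (hs : s.Finite)
    (hcov : ∀ a ∈ s, ∃ n, a ∈ lev n) : ∃ n, s ⊆ lev n :=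
  ((Filter.eventually_all_finite hs).2 fun a ha =>
    have ⟨n, hn⟩ := hcov a ha
    (Filter.eventually_ge_atTop n).mono fun _ hnm => hmono hnm hn).exists

variable {L : Type*} [LinearOrder L] {key : α → L} {B : Set α}

theorem exists_mem_level_of_finite_segments (hmono : Monotone lev)
    (hsucc : ∀ n, ∀ t ∈ B, t ∈ lev (n + 1) ↔ t ∈ lev n ∨ {s | s ∈ B ∧ key s < key t} ⊆ lev n)
    (hfin : ∀ t ∈ B, {s | s ∈ B ∧ key s < key t}.Finite) {t : α} (ht : t ∈ B) :
    ∃ n, t ∈ lev n := by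
  by_contra h
  let U := {s | s ∈ insert t {s | s ∈ B ∧ key s < key t} ∧ ¬ ∃ n, s ∈ lev n}
  obtain ⟨m, ⟨hm, hm'⟩, hmin⟩ := Set.exists_min_image U key
    (((hfin t ht).insert t).subset fun _ hs => hs.1) ⟨t, Set.mem_insert _ _, h⟩
  have hmB : m ∈ B := by
    obtain rfl | hm := hm
    exacts [ht, hm.1]
  have hmt : key m ≤ key t := by
    obtain rfl | hm := hm
    exacts [le_rfl, hm.2.le]
  obtain ⟨n, hn⟩ := exists_subset_level hmono (hfin m hmB) fun s hs => by
    by_contra hs'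
    exact hs.2.not_ge (hmin s ⟨.inr ⟨hs.1, hs.2.trans_le hmt⟩, hs'⟩)
  exact hm' ⟨n + 1, (hsucc n m hmB).2 (.inr hn)⟩

theorem injOn_levelRank (hmono : Monotone lev) (hzero : lev 0 = ∅)
    (hsucc : ∀ n, ∀ t ∈ B, t ∈ lev (n + 1) ↔ t ∈ lev n ∨ {s | s ∈ B ∧ key s < key t} ⊆ lev n)
    (hcov : ∀ t ∈ B, ∃ n, t ∈ lev n) (hinj : Set.InjOn key B) :
    Set.InjOn (levelRank lev) B := by
  suffices ∀ s ∈ B, ∀ t ∈ B, key s < key t → levelRank lev s < levelRank lev t by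
    intro s hs t ht hst
    obtain hlt | heq | hlt := lt_trichotomy (key s) (key t)
    exacts [absurd hst (this s hs t ht hlt).ne, hinj hs ht heq, absurd hst (this t ht s hs hlt).ne']
  intro s hs t ht hst
  have hrank : t ∈ lev (levelRank lev t) := (levelRank_le_iff hmono (hcov t ht)).1 le_rfl
  cases hn : levelRank lev t with
  | zero => exact (Set.eq_empty_iff_forall_notMem.1 hzero t (hn ▸ hrank)).elim
  | succ n =>
    have htn : t ∉ lev n := fun h =>
      absurd ((levelRank_le_iff hmono (hcov t ht)).2 h) (by omega)
    have hsn := ((hsucc n t ht).1 (hn ▸ hrank)).resolve_left htn ⟨hs, hst⟩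
    exact Nat.lt_succ_of_le ((levelRank_le_iff hmono (hcov s hs)).2 hsn)

end LevelRank

section Countability

variable {M : Set ZFSet.{u}} {b R : ZFSet.{u}} {lev : ℕ → Set ZFSet.{u}}

theorem countableIn_of_injOn_levelRank (hM : IsTransitiveModel M) (hb : b ∈ M) (hR : R ∈ M)
    (hmem : ∀ n, ∀ a ∈ b, ZFSet.pair (numeral n) a ∈ R ↔ a ∈ lev n) (hmono : Monotone lev)
    (hcov : ∀ a ∈ b, ∃ n, a ∈ lev n) (hinj : Set.InjOn (levelRank lev) b) : CountableIn M b := by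
  have hω := hM.omega_mem
  set f := ZFSet.sep (fun p => ∃ a ∈ b, ∃ k ∈ ZFSet.omega, p = ZFSet.pair a k ∧
    ZFSet.pair k a ∈ R ∧ ∀ j ∈ k, ZFSet.pair j a ∉ R) (ZFSet.prod b ZFSet.omega) with hf
  have hfM : f ∈ M := hM.sep_mem (by fun_prop (disch := assumption)) (hM.prod_mem hb hω)
  have hrank (a) (ha : a ∈ b) (n : ℕ) : (ZFSet.pair (numeral n) a ∈ R ∧
      ∀ j ∈ numeral n, ZFSet.pair j a ∉ R) ↔ n = levelRank lev a := by
    simp only [mem_numeral, forall_exists_index, and_imp, forall_comm (α := ZFSet.{u}),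
      forall_eq, hmem _ a ha, ← levelRank_le_iff hmono (hcov a ha), not_le]
    exact ⟨fun h => le_antisymm (not_lt.1 fun hlt => (h.2 _ hlt).false) h.1,
      fun h => ⟨h.ge, fun _ hm => hm.trans_eq h⟩⟩
  have hmemf (a k) : ZFSet.pair a k ∈ f ↔ a ∈ b ∧ k = numeral (levelRank lev a) := by
    rw [hf, ZFSet.mem_sep, ZFSet.pair_mem_prod]
    constructor
    · rintro ⟨-, a', ha, _, hk, hpair, hR⟩
      obtain ⟨rfl, rfl⟩ := ZFSet.pair_inj.1 hpair
      obtain ⟨n, rfl⟩ := mem_omega_iff.1 hk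
      exact ⟨ha, congrArg numeral ((hrank a ha n).1 hR)⟩
    · rintro ⟨ha, rfl⟩
      have hn := numeral_mem_omega (levelRank lev a)
      exact ⟨⟨ha, hn⟩, a, ha, _, hn, rfl, (hrank a ha _).2 rfl⟩
  refine ⟨f, hfM, ⟨ZFSet.sep_subset, fun a ha => ⟨_, (hmemf a _).2 ⟨ha, rfl⟩,
    fun k hk => ((hmemf a k).1 hk).2⟩⟩, fun s t n hs ht => ?_⟩
  obtain ⟨hsb, rfl⟩ := (hmemf s n).1 hs
  obtain ⟨htb, hst⟩ := (hmemf t _).1 ht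
  exact hinj hsb htb (numeral_injective hst)

theorem countableIn_of_finite_segments (hM : IsTransitiveModel M) (hb : b ∈ M) {L : Type*}
    [LinearOrder L] {key : ZFSet.{u} → L} (hinj : Set.InjOn key b)
    (hdef : DefinableRel M fun v : Fin 2 → ZFSet.{u} => v 0 ∈ b ∧ v 1 ∈ b ∧ key (v 0) < key (v 1))
    (hfin : ∀ t ∈ b, {s | s ∈ b ∧ key s < key t}.Finite) : CountableIn M b := by
  obtain ⟨P, hPM, hP⟩ := hM.exists_powerset hb
  set F : ZFSet.{u} → ZFSet.{u} := fun y =>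
    y ∪ ZFSet.sep (fun t => ∀ s ∈ b, s ∈ b ∧ t ∈ b ∧ key s < key t → s ∈ y) b with hF
  have hFdef : DefinableOp M fun v : Fin 1 → ZFSet.{u} => F (v 0) :=
    .union hM (.var 0) (.sep hM (.forall_mem hM (.const hb) (.imp
      (hdef.comp (T := ![fun w => w 0, fun w => w 1]) (Fin.forall_fin_two.2 ⟨.var 0, .var 1⟩))
      (.mem (.var 0) (.var 2)))) (.const hb))
  have hFP : Set.MapsTo F P P := fun y hy => (hP _).2
    ⟨hFdef.apply_mem (v := fun _ => y) fun _ => hM.transitive _ hPM _ hy, fun t ht =>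
      (ZFSet.mem_union.1 ht).elim (fun h => ((hP y).1 hy).2 h) fun h => (ZFSet.mem_sep.1 h).1⟩
  have hempty : ∅ ∈ P := (hP _).2 ⟨hM.empty_mem, ZFSet.empty_subset _⟩
  obtain ⟨R, hRM, hR⟩ := hM.exists_mem_iterate_graph hPM hempty hFP hFdef
  set lev : ℕ → Set ZFSet.{u} := fun n => {t | t ∈ F^[n] ∅} with hlev
  have hsucc (n : ℕ) (t) (ht : t ∈ b) :
      t ∈ lev (n + 1) ↔ t ∈ lev n ∨ {s | s ∈ b ∧ key s < key t} ⊆ lev n := by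
    simp only [hlev, Function.iterate_succ_apply', hF, Set.mem_ofPred_eq, ZFSet.mem_union,
      ZFSet.mem_sep, Set.ofPred_subset_ofPred, ht, true_and]
    grind
  have hmono : Monotone lev := monotone_nat_of_le_succ fun n t ht => by
    simp only [hlev, Function.iterate_succ_apply', hF, Set.mem_ofPred_eq, ZFSet.mem_union]
    exact .inl ht
  have hcov (t) (ht : t ∈ b) : ∃ n, t ∈ lev n :=
    exists_mem_level_of_finite_segments (B := b) hmono hsucc hfin ht
  exact countableIn_of_injOn_levelRank (lev := lev) hM hb hRM (fun n a _ => hR n a) hmono hcov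
    (injOn_levelRank (B := b) hmono (by ext; simp [hlev]) hsucc hcov hinj)

theorem eq_of_natSet_eq {x y : ZFSet.{u}} (hx : x ⊆ ZFSet.omega) (hy : y ⊆ ZFSet.omega)
    (h : natSet x = natSet y) : x = y := by
  have hle {x y : ZFSet.{u}} (hx : x ⊆ ZFSet.omega) (h : natSet x ⊆ natSet y) : x ⊆ y := by
    intro z hz
    obtain ⟨n, rfl⟩ := mem_omega_iff.1 (hx hz)
    exact h hz
  exact subset_antisymm (hle hx h.subset) (hle hy h.superset)

theorem lex_natSet_lt_iff {x y : ZFSet.{u}} :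
    (toLex (fun n => n ∈ natSet x) : Lex (ℕ → Prop)) < toLex (fun n => n ∈ natSet y) ↔
      ∃ k ∈ ZFSet.omega, (∀ j ∈ k, j ∈ x ↔ j ∈ y) ∧ k ∉ x ∧ k ∈ y := by
  constructor
  · rintro ⟨k, hlt, hk⟩
    refine ⟨_, numeral_mem_omega k, fun j hj => ?_, ?_⟩
    · obtain ⟨i, hi, rfl⟩ := mem_numeral.1 hj
      exact iff_of_eq (hlt i hi)
    · obtain ⟨-, hk⟩ := lt_iff_le_not_ge.1 hk
      exact (Classical.not_imp.1 hk).symm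
  · rintro ⟨_, hk, hlt, hkx, hky⟩
    obtain ⟨k, rfl⟩ := mem_omega_iff.1 hk
    refine ⟨k, fun j hj => propext (hlt _ (numeral_mem_numeral.2 hj)), ?_⟩
    exact lt_iff_le_not_ge.2 ⟨fun _ => hky, fun h => hkx (h hky)⟩

open Classical in
theorem countableIn_of_levels (hM : IsTransitiveModel M) (hb : b ∈ M) (hR : R ∈ M)
    (hbω : ∀ a ∈ b, a ⊆ ZFSet.omega)
    (hmem : ∀ n, ∀ a ∈ b, ZFSet.pair (numeral n) a ∈ R ↔ a ∈ lev n) (hmono : Monotone lev)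
    (hcov : ∀ a ∈ b, ∃ n, a ∈ lev n) (hfin : ∀ n, (lev n).Finite) : CountableIn M b := by
  have hω := hM.omega_mem
  let key (a : ZFSet.{u}) : ℕ ×ₗ Lex (ℕ → Prop) :=
    toLex (levelRank lev a, toLex fun n => n ∈ natSet a)
  have hlt (s t) : key s < key t ↔ levelRank lev s < levelRank lev t ∨
      levelRank lev s = levelRank lev t ∧
        ∃ k ∈ ZFSet.omega, (∀ j ∈ k, j ∈ s ↔ j ∈ t) ∧ k ∉ s ∧ k ∈ t := by
    rw [Prod.Lex.toLex_lt_toLex, lex_natSet_lt_iff]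
  refine countableIn_of_finite_segments hM hb (key := key) (fun s hs t ht hst => ?_) ?_ ?_
  · refine eq_of_natSet_eq (hbω s hs) (hbω t ht) (Set.ext fun n => iff_of_eq ?_)
    exact congrFun (congrArg (fun p => ofLex (ofLex p).2) hst) n
  · refine DefinableRel.congr (P := fun v => v 0 ∈ b ∧ v 1 ∈ b ∧
      ((∃ n ∈ ZFSet.omega, ZFSet.pair n (v 0) ∈ R ∧ ZFSet.pair n (v 1) ∉ R) ∨
        (∀ n ∈ ZFSet.omega, ZFSet.pair n (v 0) ∈ R ↔ ZFSet.pair n (v 1) ∈ R) ∧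
          ∃ k ∈ ZFSet.omega, (∀ j ∈ k, j ∈ v 0 ↔ j ∈ v 1) ∧ k ∉ v 0 ∧ k ∈ v 1))
      (by fun_prop (disch := assumption)) fun v _ =>
        and_congr_right fun hs => and_congr_right fun ht => ?_
    rw [hlt, levelRank_lt_iff hmono (hcov _ hs) (hcov _ ht),
      levelRank_eq_iff hmono (hcov _ hs) (hcov _ ht)]
    simp only [← hmem _ _ hs, ← hmem _ _ ht, exists_mem_omega, forall_mem_omega]
  · refine fun t _ => (hfin (levelRank lev t)).subset fun s ⟨hs, hst⟩ => ?_
    rw [← levelRank_le_iff hmono (hcov s hs)]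
    exact ((hlt s t).1 hst).elim le_of_lt fun h => h.1.le

end Countability

/-! ### Countable sets of coordinates -/

section CohenClosure

variable {M : Set ZFSet.{u}} {A D P s : ZFSet.{u}} {G : ZFSet.{u} → ZFSet.{u}}

/-- One step of closing a set `s ⊆ A` under an operation `G` on conditions: add to `s` the domains
of the values `G h` at the conditions `h ∈ P` with domain contained in `s`. -/
noncomputable def condClosureStep (A P : ZFSet.{u}) (G : ZFSet.{u} → ZFSet.{u}) (s : ZFSet.{u}) :
    ZFSet.{u} :=
  s ∪ ZFSet.sep (fun a => ∃ h ∈ P, (∀ x ∈ A, ∀ i ∈ ({numeral 0, numeral 1} : ZFSet.{u}),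
    ZFSet.pair x i ∈ h → x ∈ s) ∧
      ∃ i ∈ ({numeral 0, numeral 1} : ZFSet.{u}), ZFSet.pair a i ∈ G h) A

theorem mem_condClosureStep (hP : ∀ h, h ∈ P ↔ IsCohen A h)
    (hG : ∀ h, IsCohen A h → IsCohen A (G h)) {a : ZFSet.{u}} :
    a ∈ condClosureStep A P G s ↔
      a ∈ s ∨ ∃ h, IsCohen A h ∧ condDom h ⊆ s ∧ a ∈ condDom (G h) := by
  simp only [condClosureStep, ZFSet.mem_union, ZFSet.mem_sep, hP]
  refine or_congr_right ⟨fun ⟨_, h, hh, hdom, i, _, hi⟩ => ?_, fun ⟨h, hh, hdom, i, hi⟩ => ?_⟩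
  · refine ⟨h, hh, fun x ⟨j, hj⟩ => ?_, i, hi⟩
    exact hdom x (hh.mem_of_pair_mem hj).1 j (hh.mem_of_pair_mem hj).2 hj
  · exact ⟨((hG h hh).mem_of_pair_mem hi).1, h, hh, fun x _ j _ hj => hdom ⟨j, hj⟩, i,
      ((hG h hh).mem_of_pair_mem hi).2, hi⟩

theorem finite_condClosureStep (hP : ∀ h, h ∈ P ↔ IsCohen A h)
    (hG : ∀ h, IsCohen A h → IsCohen A (G h)) (hs : (s : Set ZFSet.{u}).Finite) :
    (condClosureStep A P G s : Set ZFSet.{u}).Finite := by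
  refine (hs.union ((finite_setOf_isCohen_condDom_subset (X := A) hs).biUnion fun h hh =>
    condDom_finite (hG h hh.1).2.1)).subset fun a ha => ?_
  refine ((mem_condClosureStep hP hG).1 ha).imp id fun ⟨h, hh, hdom, ha⟩ => ?_
  exact Set.mem_biUnion (x := h) ⟨hh, hdom⟩ ha

theorem DefinableOp.condClosureStep (hM : IsTransitiveModel M) (hA : A ∈ M) (hP : P ∈ M)
    (hG : DefinableOp M fun v : Fin 1 → ZFSet.{u} => G (v 0)) :
    DefinableOp M fun v : Fin 1 → ZFSet.{u} => condClosureStep A P G (v 0) := by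
  have h2 := hM.two_mem
  refine .union hM (.var 0) (.sep hM (.exists_mem hM (.const hP) (.and ?_
    (.exists_mem hM (.const h2) (.mem ?_ (hG.comp fun _ => .var 1))))) (.const hA))
    <;> fun_prop (disch := assumption)

theorem exists_countable_condClosed (hM : IsTransitiveModel M) (hA : A ∈ M)
    (hAω : ∀ a ∈ A, a ⊆ ZFSet.omega) (hGdef : DefinableOp M fun v : Fin 1 → ZFSet.{u} => G (v 0))
    (hG : ∀ h, IsCohen A h → IsCohen A (G h)) :
    ∃ b ∈ M, b ⊆ A ∧ CountableIn M b ∧ ∀ h, IsCohen b h → IsCohen b (G h) := by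
  obtain ⟨P, hPM, hP⟩ := hM.exists_cohen hA
  obtain ⟨Q, hQM, hQ⟩ := hM.exists_powerset hA
  let F := condClosureStep A P G
  have hFdef := DefinableOp.condClosureStep hM hA hPM hGdef
  have hmem (n : ℕ) (a : ZFSet.{u}) : a ∈ F^[n + 1] ∅ ↔ a ∈ F^[n] ∅ ∨
      ∃ h, IsCohen A h ∧ condDom h ⊆ F^[n] ∅ ∧ a ∈ condDom (G h) := by
    rw [Function.iterate_succ_apply']
    exact mem_condClosureStep hP hG
  have hFQ : Set.MapsTo F Q Q := fun s hs => (hQ _).2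
    ⟨hFdef.apply_mem (v := fun _ => s) fun _ => hM.transitive _ hQM _ hs, fun a ha =>
      ((mem_condClosureStep hP hG).1 ha).elim (fun h => ((hQ s).1 hs).2 h)
        fun ⟨h, hh, _, i, hi⟩ => ((hG h hh).mem_of_pair_mem hi).1⟩
  have hempty : ∅ ∈ Q := (hQ _).2 ⟨hM.empty_mem, ZFSet.empty_subset _⟩
  obtain ⟨R, hRM, hR⟩ := hM.exists_mem_iterate_graph hQM hempty hFQ hFdef
  obtain ⟨b, hbM, hb⟩ := hM.exists_iUnion_iterate hQM hempty hFQ hFdef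
  have hbA : b ⊆ A := fun a ha =>
    have ⟨n, hn⟩ := (hb a).1 ha
    ((hQ _).1 (hFQ.iterate n hempty)).2 hn
  have hmono : Monotone fun n => (F^[n] ∅ : Set ZFSet.{u}) :=
    monotone_nat_of_le_succ fun n a ha => (hmem n a).2 (.inl ha)
  have hfin (n : ℕ) : (F^[n] ∅ : Set ZFSet.{u}).Finite := by
    induction n with
    | zero => simp
    | succ n ih =>
      rw [Function.iterate_succ_apply']
      exact finite_condClosureStep hP hG ih
  refine ⟨b, hbM, hbA, countableIn_of_levels hM hbM hRM (fun a ha => hAω a (hbA ha))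
    (fun n a _ => hR n a) hmono (fun a => (hb a).1) hfin, fun h hh => ?_⟩
  obtain ⟨n, hn⟩ := exists_subset_level hmono (condDom_finite hh.2.1) fun a ⟨i, hi⟩ =>
    (hb a).1 (hh.mem_of_pair_mem hi).1
  exact (hG h (hh.mono hbA)).of_condDom_subset fun a ha =>
    (hb a).2 ⟨n + 1, (hmem n a).2 (.inr ⟨h, hh.mono hbA, hn, ha⟩)⟩

theorem IsCohenDense.exists_countable (hM : IsTransitiveModel M) (hA : A ∈ M)
    (hAω : ∀ a ∈ A, a ⊆ ZFSet.omega) (hD : D ∈ M) (hDA : IsCohenDense A D) :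
    ∃ b ∈ M, b ⊆ A ∧ CountableIn M b ∧ ∀ h, IsCohen b h → ∃ g ∈ D, IsCohen b g ∧ h ⊆ g := by
  obtain ⟨P, hPM, hP⟩ := hM.exists_cohen hA
  obtain ⟨G, hGdef, hG⟩ := hM.exists_choice_function hPM hD (r := fun h g => h ⊆ g)
    (by fun_prop (disch := assumption)) fun h hh => hDA.2 h ((hP h).1 hh)
  obtain ⟨b, hbM, hbA, hbc, hb⟩ := exists_countable_condClosed hM hA hAω hGdef fun h hh =>
    hDA.1 _ (hG h ((hP h).2 hh)).1
  refine ⟨b, hbM, hbA, hbc, fun h hh => ?_⟩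
  obtain ⟨hGD, hhG⟩ := hG h ((hP h).2 (hh.mono hbA))
  exact ⟨G h, hGD, hb h hh, hhG⟩

end CohenClosure

/-! ### Transport of Cohen conditions -/

section Transport

variable {ρ : ZFSet.{u} → ZFSet.{u} → Prop} {A C D X Y b g h : ZFSet.{u}}

/-- The pullback of a condition `h` on `Y` to a condition on `X` along a relation `ρ` between `X`
and `Y`. -/
noncomputable def pullCohen (ρ : ZFSet.{u} → ZFSet.{u} → Prop) (X Y h : ZFSet.{u}) : ZFSet.{u} :=
  ZFSet.sep (fun q => ∃ a ∈ X, ∃ i ∈ ({numeral 0, numeral 1} : ZFSet.{u}), ∃ n ∈ Y,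
    q = ZFSet.pair a i ∧ ρ a n ∧ ZFSet.pair n i ∈ h) (ZFSet.prod X {numeral 0, numeral 1})

theorem pair_mem_pullCohen (hh : IsCohen Y h) {a i : ZFSet.{u}} :
    ZFSet.pair a i ∈ pullCohen ρ X Y h ↔ a ∈ X ∧ ∃ n, ρ a n ∧ ZFSet.pair n i ∈ h := by
  rw [pullCohen, ZFSet.mem_sep, ZFSet.pair_mem_prod]
  constructor
  · rintro ⟨-, a', ha, i', -, n, -, hpair, hn, hi⟩
    obtain ⟨rfl, rfl⟩ := ZFSet.pair_inj.1 hpair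
    exact ⟨ha, n, hn, hi⟩
  · rintro ⟨ha, n, hn, hi⟩
    obtain ⟨hnY, hi2⟩ := hh.mem_of_pair_mem hi
    exact ⟨⟨ha, hi2⟩, a, ha, i, hi2, n, hnY, rfl, hn, hi⟩

theorem DefinableOp.pullCohen {M : Set ZFSet.{u}} (hM : IsTransitiveModel M) (hX : X ∈ M)
    (hY : Y ∈ M) (hρ : DefinableRel M fun v : Fin 2 → ZFSet.{u} => ρ (v 0) (v 1)) :
    DefinableOp M fun v : Fin 1 → ZFSet.{u} => pullCohen ρ X Y (v 0) := by
  have h2 := hM.two_mem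
  have hprod := hM.prod_mem hX h2
  refine .sep hM (.exists_mem hM (.const hX) (.exists_mem hM (.const h2) (.exists_mem hM (.const hY)
    (.and ?_ (.and (hρ.comp (T := ![fun w => w 2, fun w => w 0])
      (Fin.forall_fin_two.2 ⟨.var 2, .var 0⟩)) ?_))))) (.const hprod) <;>
    fun_prop (disch := assumption)

theorem pullCohen_mono (hh : IsCohen Y h) (hg : IsCohen Y g) (hhg : h ⊆ g) :
    pullCohen ρ X Y h ⊆ pullCohen ρ X Y g := by
  intro q hq
  obtain ⟨a, -, i, -, rfl⟩ := ZFSet.mem_prod.1 (ZFSet.mem_sep.1 hq).1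
  obtain ⟨ha, n, hn, hi⟩ := (pair_mem_pullCohen hh).1 hq
  exact (pair_mem_pullCohen hg).2 ⟨ha, n, hn, hhg hi⟩

theorem biUnique_flip (hρ : Relator.BiUnique ρ) : Relator.BiUnique (flip ρ) :=
  ⟨fun _ _ _ h h' => hρ.2 h h', hρ.1.flip⟩

theorem IsCohen.pullCohen (hh : IsCohen Y h) (hρ : Relator.BiUnique ρ) :
    IsCohen X (pullCohen ρ X Y h) := by
  refine ⟨ZFSet.sep_subset, ?_, fun a i j hi hj => ?_⟩
  · have hdom := (condDom_finite hh.2.1).biUnion (t := fun n => {a | ρ a n}) fun n _ =>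
      Set.Subsingleton.finite fun a ha b hb => hρ.1 ha hb
    refine (hdom.image2 ZFSet.pair (Set.toFinite {numeral 0, numeral 1})).subset fun q hq => ?_
    obtain ⟨a, -, i, hi2, rfl⟩ := ZFSet.mem_prod.1 (ZFSet.mem_sep.1 hq).1
    obtain ⟨-, n, hn, hi⟩ := (pair_mem_pullCohen hh).1 hq
    exact ⟨a, Set.mem_biUnion (x := n) ⟨i, hi⟩ hn, i, ZFSet.mem_pair.1 hi2, rfl⟩
  · obtain ⟨-, n, hn, hi⟩ := (pair_mem_pullCohen hh).1 hi
    obtain ⟨-, m, hm, hj⟩ := (pair_mem_pullCohen hh).1 hj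
    obtain rfl := hρ.2 hn hm
    exact hh.2.2 n i j hi hj

theorem IsCohen.union_pullCohen (hh : IsCohen X h) (hg : IsCohen Y g) (hρ : Relator.BiUnique ρ)
    (hhg : _root_.pullCohen (flip ρ) Y X h ⊆ g) : IsCohen X (h ∪ _root_.pullCohen ρ X Y g) := by
  refine hh.union (hg.pullCohen hρ) fun a i j hi hj => ?_
  obtain ⟨-, n, hn, hj⟩ := (pair_mem_pullCohen hg).1 hj
  exact hg.2.2 n i j (hhg ((pair_mem_pullCohen hh).2 ⟨(hg.mem_of_pair_mem hj).1, a, hn, hi⟩)) hj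

theorem IsCohenDense.of_pullCohen_subset (hC : IsCohenDense Y C) (hρ : Relator.BiUnique ρ)
    (hD : ∀ h, h ∈ D ↔ IsCohen X h ∧ ∃ g ∈ C, pullCohen ρ X Y g ⊆ h) : IsCohenDense X D := by
  refine ⟨fun h hh => ((hD h).1 hh).1, fun h hh => ?_⟩
  obtain ⟨g, hgC, hhg⟩ := hC.2 _ (hh.pullCohen (biUnique_flip hρ))
  exact ⟨h ∪ pullCohen ρ X Y g, (hD _).2 ⟨hh.union_pullCohen (hC.1 g hgC) hρ hhg, g, hgC,
    fun _ hq => ZFSet.mem_union.2 (.inr hq)⟩, fun _ hq => ZFSet.mem_union.2 (.inl hq)⟩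

theorem isCohenDense_of_subset_pullCohen (hρ : Relator.BiUnique ρ) (hbX : b ⊆ X)
    (hb : ∀ a ∈ b, ∃ n ∈ Y, ρ a n) (hD : ∀ h, IsCohen b h → ∃ g ∈ D, IsCohen b g ∧ h ⊆ g)
    (hC : ∀ h, h ∈ C ↔ IsCohen Y h ∧ ∃ g ∈ D, g ⊆ pullCohen ρ X Y h) : IsCohenDense Y C := by
  refine ⟨fun h hh => ((hC h).1 hh).1, fun h hh => ?_⟩
  obtain ⟨g, hgD, hg, hhg⟩ := hD _ (hh.pullCohen hρ)
  have hunion := hh.union_pullCohen hg (biUnique_flip hρ) hhg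
  refine ⟨h ∪ pullCohen (flip ρ) Y b g, (hC _).2 ⟨hunion, g, hgD, hg.subset_iff.2 fun a i hi => ?_⟩,
    fun _ hq => ZFSet.mem_union.2 (.inl hq)⟩
  have ha := (hg.mem_of_pair_mem hi).1
  obtain ⟨n, hnY, hn⟩ := hb a ha
  exact (pair_mem_pullCohen hunion).2 ⟨hbX ha, n, hn,
    ZFSet.mem_union.2 (.inr ((pair_mem_pullCohen hg).2 ⟨hnY, a, hn, hi⟩))⟩

theorem biUnique_pair_mem {f : ZFSet.{u}} (hf : ZFSet.IsFunc X Y f)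
    (hinj : ∀ y z n, ZFSet.pair y n ∈ f → ZFSet.pair z n ∈ f → y = z) :
    Relator.BiUnique fun a n => ZFSet.pair a n ∈ f :=
  ⟨fun _ _ _ h h' => hinj _ _ _ h h',
    fun _ _ _ h h' => (hf.2 _ (ZFSet.pair_mem_prod.1 (hf.1 h)).1).unique h h'⟩

theorem CohenPreserving.exists_refines {V W : Set ZFSet.{u}} (hVW : CohenPreserving V W)
    (hV : IsTransitiveModel V) (hW : IsTransitiveModel W) (hsub : V ⊆ W) (hA : A ∈ V)
    (hAω : ∀ a ∈ A, a ⊆ ZFSet.omega) (hcov : CountableCovering V W A) (hD : D ∈ W)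
    (hDA : IsCohenDense A D) : ∃ C ∈ V, IsCohenDense A C ∧ Refines C D := by
  obtain ⟨b, hbW, hbA, hbc, hbD⟩ := hDA.exists_countable hW (hsub hA) hAω hD
  obtain ⟨b', -, ⟨f, hfV, hf, hinj⟩, hbb'⟩ := hcov b hbW hbA hbc
  have hρ := biUnique_pair_mem hf hinj
  set pull := pullCohen (fun a n => ZFSet.pair a n ∈ f) A ZFSet.omega
  have hpull {M : Set ZFSet.{u}} (hM : IsTransitiveModel M) (hA : A ∈ M) (hf : f ∈ M) :
      DefinableOp M fun v : Fin 1 → ZFSet.{u} => pull (v 0) :=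
    .pullCohen hM hA hM.omega_mem (.mem (.pair hM (.var 0) (.var 1)) (.const hf))
  obtain ⟨D', hD'W, hD'⟩ := hW.exists_cohen_sep hW.omega_mem (P := fun h => ∃ g ∈ D, g ⊆ pull h)
    (.exists_mem hW (.const hD) (.subset hW (.var 0)
      ((hpull hW (hsub hA) (hsub hfV)).comp fun _ => .var 1)))
  have hD'ω := isCohenDense_of_subset_pullCohen hρ hbA (fun a ha => by
    obtain ⟨n, hn, -⟩ := hf.2 a (hbb' ha)
    exact ⟨n, (ZFSet.pair_mem_prod.1 (hf.1 hn)).2, hn⟩) hbD hD'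
  obtain ⟨C', hC'V, hC'ω, hC'D'⟩ := hVW D' hD'W hD'ω
  obtain ⟨C, hCV, hC⟩ := hV.exists_cohen_sep hA (P := fun h => ∃ g ∈ C', pull g ⊆ h)
    (.exists_mem hV (.const hC'V) (.subset hV
      ((hpull hV hA hfV).comp fun _ => .var 0) (.var 1)))
  refine ⟨C, hCV, hC'ω.of_pullCohen_subset hρ hC, fun h hh => ?_⟩
  obtain ⟨-, g, hgC', hgh⟩ := (hC h).1 hh
  obtain ⟨d, hd, hdg⟩ := hC'D' g hgC'
  obtain ⟨hdω, k, hkD, hkd⟩ := (hD' d).1 hd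
  exact ⟨k, hkD, fun _ hq => hgh (pullCohen_mono hdω (hC'ω.1 g hgC') hdg (hkd hq))⟩

end Transport

/-! ### The density filter -/

section DensityFilter

variable {M : Set ZFSet.{u}} {A X g h : ZFSet.{u}} {S : Set ℕ}

theorem cohenInter_anti (hgh : g ⊆ h) : cohenInter h ⊆ cohenInter g :=
  fun _ hn a => ⟨fun ha => (hn a).1 (hgh ha), fun ha => (hn a).2 (hgh ha)⟩

/-- The relation `k ∈ A ^ h` between sets. The quantifier of `cohenInter` is bounded by `A`, so that
the relation is visibly definable over transitive models. -/
def InCohenInter (A h k : ZFSet.{u}) : Prop :=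
  ∀ a ∈ A, (ZFSet.pair a (numeral 1) ∈ h → k ∈ a) ∧ (ZFSet.pair a (numeral 0) ∈ h → k ∉ a)

theorem inCohenInter_numeral (hh : IsCohen A h) {n : ℕ} :
    InCohenInter A h (numeral n) ↔ n ∈ cohenInter h :=
  ⟨fun hn a => ⟨fun ha => (hn a (hh.mem_of_pair_mem ha).1).1 ha,
    fun ha => (hn a (hh.mem_of_pair_mem ha).1).2 ha⟩, fun hn a _ => hn a⟩

theorem DefinableRel.inCohenInter (hM : IsTransitiveModel M) (hA : A ∈ M) {n : ℕ}
    {T U : (Fin n → ZFSet.{u}) → ZFSet.{u}} (hT : DefinableOp M T) (hU : DefinableOp M U) :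
    DefinableRel M fun v => InCohenInter A (T v) (U v) := by
  have h0 := hM.numeral_mem 0
  have h1 := hM.numeral_mem 1
  have hdef : DefinableRel M fun v : Fin 2 → ZFSet.{u} => InCohenInter A (v 0) (v 1) := by
    unfold InCohenInter
    fun_prop (disch := assumption)
  exact hdef.comp (T := ![T, U]) (Fin.forall_fin_two.2 ⟨hT, hU⟩)

theorem IsIndependent.infinite_cohenInter (hA : IsIndependent A) (hh : IsCohen A h) :
    (cohenInter h).Infinite := by
  classical
  set f : ZFSet.{u} → Bool := fun a => decide (ZFSet.pair a (numeral 1) ∈ h) with hf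
  refine (hA.2 f ((fun a => if f a = true then natSet a else (natSet a)ᶜ) '' condDom h) ?_
    ((condDom_finite hh.2.1).image _)).mono fun n hn a => ⟨fun ha => ?_, fun ha => ?_⟩
  · rintro _ ⟨a, ⟨i, hi⟩, rfl⟩
    exact ⟨a, (hh.mem_of_pair_mem hi).1, rfl⟩
  · simpa [hf, ha] using hn _ ⟨a, ⟨_, ha⟩, rfl⟩
  · have h1 : ZFSet.pair a (numeral 1) ∉ h := fun h1 =>
      zero_ne_one (numeral_injective (hh.2.2 a _ _ ha h1))
    simpa [hf, h1] using hn _ ⟨a, ⟨_, ha⟩, rfl⟩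

namespace IsTransitiveModel

theorem exists_natSet_eq (hM : IsTransitiveModel M) {P : ZFSet.{u} → Prop}
    (hP : DefinableRel M fun v : Fin 1 → ZFSet.{u} => P (v 0)) :
    ∃ x ∈ M, x ⊆ ZFSet.omega ∧ natSet x = {n | P (numeral n)} :=
  ⟨_, hM.sep_mem hP hM.omega_mem, ZFSet.sep_subset, Set.ext fun n =>
    ZFSet.mem_sep.trans (and_iff_right (numeral_mem_omega n))⟩

theorem exists_natSet_eq_compl (hM : IsTransitiveModel M) (hX : X ∈ M) :
    ∃ x ∈ M, x ⊆ ZFSet.omega ∧ natSet x = (natSet X)ᶜ :=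
  hM.exists_natSet_eq (P := fun k => k ∉ X) (by fun_prop (disch := assumption))

theorem exists_natSet_eq_of_finite_compl (hM : IsTransitiveModel M) (hS : Sᶜ.Finite) :
    ∃ x ∈ M, x ⊆ ZFSet.omega ∧ natSet x = S := by
  set y := ZFSet.sep (fun k => ∃ n ∈ Sᶜ, numeral n = k) ZFSet.omega with hy
  have hyfin : (y : Set ZFSet.{u}).Finite :=
    (hS.image numeral).subset fun k hk => (ZFSet.mem_sep.1 hk).2
  have hyM : y ∈ M := hM.mem_of_finite hyfin fun k hk =>
    hM.transitive _ hM.omega_mem _ (ZFSet.mem_sep.1 hk).1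
  obtain ⟨x, hxM, hxω, hx⟩ := hM.exists_natSet_eq_compl hyM
  refine ⟨x, hxM, hxω, hx.trans (compl_eq_comm.1 (Set.ext fun n => ?_))⟩
  simp only [natSet, hy, Set.mem_ofPred_eq, ZFSet.mem_sep, numeral_mem_omega, true_and,
    numeral_injective.eq_iff, exists_eq_right]

theorem exists_natSet_eq_cohenInter (hM : IsTransitiveModel M) (hA : A ∈ M) (hh : IsCohen A h) :
    ∃ x ∈ M, x ⊆ ZFSet.omega ∧ natSet x = cohenInter h := by
  obtain ⟨x, hxM, hxω, hx⟩ := hM.exists_natSet_eq (P := InCohenInter A h)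
    (.inCohenInter hM hA (.const (hh.mem hM hA)) (.var 0))
  exact ⟨x, hxM, hxω, hx.trans (Set.ext fun n => inCohenInter_numeral hh)⟩

theorem exists_natSet_eq_of_isCohenDense (hM : IsTransitiveModel M) (hA : A ∈ M) {D : ZFSet.{u}}
    (hD : D ∈ M) (hDA : IsCohenDense A D) :
    ∃ x ∈ M, x ⊆ ZFSet.omega ∧ natSet x = {n | ∃ h ∈ D, n ∈ cohenInter h} := by
  obtain ⟨x, hxM, hxω, hx⟩ := hM.exists_natSet_eq (P := fun k => ∃ h ∈ D, InCohenInter A h k)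
    (.exists_mem hM (.const hD) (.inCohenInter hM hA (.var 0) (.var 1)))
  exact ⟨x, hxM, hxω, hx.trans (Set.ext fun n =>
    exists_congr fun h => and_congr_right fun hh => inCohenInter_numeral (hDA.1 h hh))⟩

end IsTransitiveModel

theorem exists_cohenInter_subset (hS : S ∈ densityFilter M A) (hh : IsCohen A h) :
    ∃ g, IsCohen A g ∧ h ⊆ g ∧ cohenInter g ⊆ S := by
  induction hS generalizing h with
  | basic hs =>
    obtain ⟨D, -, hD, rfl⟩ := hs
    obtain ⟨g, hg, hhg⟩ := hD.2 h hh
    exact ⟨g, hD.1 g hg, hhg, fun n hn => ⟨g, hg, hn⟩⟩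
  | univ => exact ⟨h, hh, fun _ => id, Set.subset_univ _⟩
  | superset _ hst ih =>
    obtain ⟨g, hg, hhg, hgs⟩ := ih hh
    exact ⟨g, hg, hhg, hgs.trans hst⟩
  | inter _ _ ih₁ ih₂ =>
    obtain ⟨g, hg, hhg, hgs⟩ := ih₁ hh
    obtain ⟨k, hk, hgk, hks⟩ := ih₂ hg
    exact ⟨k, hk, fun _ hq => hgk (hhg hq), Set.subset_inter ((cohenInter_anti hgk).trans hgs) hks⟩

theorem natSet_mem_densityFilter_iff (hM : IsTransitiveModel M) (hA : A ∈ M) (hX : X ∈ M) :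
    natSet X ∈ densityFilter M A ↔
      ∀ h, IsCohen A h → ∃ g, IsCohen A g ∧ h ⊆ g ∧ cohenInter g ⊆ natSet X := by
  refine ⟨fun hmem h hh => exists_cohenInter_subset hmem hh, fun hX' => ?_⟩
  have hω := hM.omega_mem
  obtain ⟨D, hDM, hD⟩ := hM.exists_cohen_sep hA
    (P := fun h => ∀ k ∈ ZFSet.omega, InCohenInter A h k → k ∈ X)
    (.forall_mem hM (.const hω) (.imp (.inCohenInter hM hA (.var 1) (.var 0))
      (.mem (.var 0) (.const hX))))
  replace hD (h) : h ∈ D ↔ IsCohen A h ∧ cohenInter h ⊆ natSet X := by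
    rw [hD, forall_mem_omega]
    exact and_congr_right fun hh => forall_congr' fun n =>
      imp_congr_left (inCohenInter_numeral hh)
  refine Filter.mem_of_superset (Filter.mem_generate_of_mem ⟨D, hDM, ⟨fun h hh => ((hD h).1 hh).1,
    fun h hh => ?_⟩, rfl⟩) fun n ⟨h, hh, hn⟩ => ((hD h).1 hh).2 hn
  obtain ⟨g, hg, hhg, hgX⟩ := hX' h hh
  exact ⟨g, (hD g).2 ⟨hg, hgX⟩, hhg⟩

theorem IsDenseSystem.exists_cohenInter_sdiff_finite (hA : IsDenseSystem M A)
    (hM : IsTransitiveModel M) (hAM : A ∈ M) (hX : X ∈ M) (hXω : X ⊆ ZFSet.omega)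
    (hcof : densityFilter M A ≤ Filter.cofinite) (hXc : (natSet X)ᶜ ∉ densityFilter M A) :
    ∃ h, IsCohen A h ∧ (cohenInter h \ natSet X).Finite := by
  contrapose! hXc
  obtain ⟨Y, hY, -, hYX⟩ := hM.exists_natSet_eq_compl hX
  rw [← hYX, natSet_mem_densityFilter_iff hM hAM hY]
  intro h hh
  obtain ⟨g, hg, hhg, hgX⟩ := hA.2 X hX hXω h hh
  have hfin := hgX.resolve_left (hXc g hg)
  obtain ⟨k, hk, hgk, hkX⟩ := exists_cohenInter_subset (hcof hfin.compl_mem_cofinite) hg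
  exact ⟨k, hk, fun _ hq => hgk (hhg hq),
    fun n hn => hYX ▸ fun hnX => hkX hn ⟨cohenInter_anti hgk hn, hnX⟩⟩

theorem densityFilter_eq_of_refines {V W : Set ZFSet.{u}} (hVW : V ⊆ W)
    (hD : ∀ D ∈ W, IsCohenDense A D → ∃ C ∈ V, IsCohenDense A C ∧ Refines C D) :
    densityFilter W A = densityFilter V A := by
  refine le_antisymm (Filter.le_generate_iff.2 ?_) (Filter.le_generate_iff.2 ?_)
  · rintro _ ⟨D, hDV, hDA, rfl⟩
    exact Filter.mem_generate_of_mem ⟨D, hVW hDV, hDA, rfl⟩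
  · rintro _ ⟨D, hDW, hDA, rfl⟩
    obtain ⟨C, hC, hCA, hCD⟩ := hD D hDW hDA
    refine Filter.mem_of_superset (Filter.mem_generate_of_mem ⟨C, hC, hCA, rfl⟩) ?_
    rintro n ⟨h, hh, hn⟩
    obtain ⟨g, hg, hgh⟩ := hCD h hh
    exact ⟨g, hg, cohenInter_anti hgh hn⟩

end DensityFilter

/-! ### Free sequences -/

section Centered

variable {F : Set (Set ℕ)} {s t : Set ℕ}

theorem centered_insert_iff : Centered (insert s F) ↔
    ∀ S ∈ Filter.generate (F ∪ {S | Sᶜ.Finite}), (S ∩ s).Infinite := by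
  constructor
  · intro h S hS
    rw [Filter.generate_union] at hS
    obtain ⟨S₁, hS₁, S₂, hS₂, rfl⟩ := Filter.mem_inf_iff.1 hS
    have hcof : S₂ᶜ.Finite := (Filter.le_generate_iff (f := Filter.cofinite)).2 (fun _ => id) hS₂
    obtain ⟨T, hTF, hT, hTS⟩ := Filter.mem_generate_iff.1 hS₁
    refine ((h (insert s T) (Set.insert_subset_insert hTF) (hT.insert s)).sdiff hcof).mono ?_
    rintro n ⟨hn, hnS⟩
    rw [Set.sInter_insert] at hn
    exact ⟨⟨hTS hn.2, not_not.1 hnS⟩, hn.1⟩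
  · intro h T hTF hT
    refine (h (⋂₀ (T \ {s})) ((Filter.sInter_mem hT.sdiff).2 fun t ht => ?_)).mono ?_
    · exact Filter.mem_generate_of_mem (.inl ((hTF ht.1).resolve_left ht.2))
    · rw [Set.inter_comm, ← Set.sInter_insert, Set.insert_sdiff_singleton]
      exact Set.sInter_subset_sInter (Set.subset_insert s T)

theorem Centered.insert_of_sdiff_finite (h : Centered (insert s F)) (hst : (s \ t).Finite) :
    Centered (insert t F) := by
  rw [centered_insert_iff] at h ⊢
  refine fun S hS => ((h S hS).sdiff hst).mono ?_
  rintro n ⟨⟨hnS, hns⟩, hnst⟩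
  exact ⟨hnS, not_not.1 fun hnt => hnst ⟨hns, hnt⟩⟩

end Centered

section FreeSequence

variable {M : Set ZFSet.{u}} {A B X Y α β γ a : ZFSet.{u}}

theorem mem_of_pair_mem_of_isFunc (hB : ZFSet.IsFunc γ (ZFSet.powerset ZFSet.omega) B)
    (ha : ZFSet.pair α a ∈ B) : α ∈ γ ∧ a ⊆ ZFSet.omega :=
  (ZFSet.pair_mem_prod.1 (hB.1 ha)).imp_right ZFSet.mem_powerset.1

theorem sequenceFilter_le_cofinite : sequenceFilter B ≤ Filter.cofinite :=
  fun _ hS => Filter.mem_generate_of_mem (.inr hS)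

theorem IsAssociated.sequenceFilter_eq (h : IsAssociated M A γ B) (hM : IsTransitiveModel M)
    (hA : A ∈ M) (hB : B ∈ M) : sequenceFilter B = densityFilter M A := by
  refine le_antisymm (Filter.le_generate_iff.2 ?_) (Filter.le_generate_iff.2 fun S hS => ?_)
  · rintro _ ⟨D, hD, hDA, rfl⟩
    obtain ⟨x, hx, hxω, hxD⟩ := hM.exists_natSet_eq_of_isCohenDense hA hD hDA
    exact hxD ▸ (h.2 x hx hxω).2 (hxD ▸ Filter.mem_generate_of_mem ⟨D, hD, hDA, rfl⟩)
  · obtain ⟨x, hx, hxω, rfl⟩ : ∃ x ∈ M, x ⊆ ZFSet.omega ∧ natSet x = S := by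
      rcases hS with ⟨α, a, ha, rfl⟩ | hS
      · exact ⟨a, (hM.mem_of_pair_mem (hM.transitive _ hB _ ha)).2,
          (mem_of_pair_mem_of_isFunc h.1.1.2.1 ha).2, rfl⟩
      · exact hM.exists_natSet_eq_of_finite_compl hS
    exact (h.2 x hx hxω).1 (Filter.mem_generate_of_mem hS)

theorem isFunc_insert_pair (hB : ZFSet.IsFunc γ Y B) (hX : X ∈ Y) :
    ZFSet.IsFunc (insert γ γ) Y (insert (ZFSet.pair γ X) B) := by
  refine ⟨fun p hp => ?_, fun α hα => ?_⟩
  · rcases ZFSet.mem_insert_iff.1 hp with rfl | hp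
    · exact ZFSet.pair_mem_prod.2 ⟨ZFSet.mem_insert _ _, hX⟩
    · obtain ⟨α, hα, a, ha, rfl⟩ := ZFSet.mem_prod.1 (hB.1 hp)
      exact ZFSet.pair_mem_prod.2 ⟨ZFSet.mem_insert_of_mem _ hα, ha⟩
  · simp only [ZFSet.mem_insert_iff, ZFSet.pair_inj]
    rcases ZFSet.mem_insert_iff.1 hα with rfl | hα
    · exact ⟨X, .inl ⟨rfl, rfl⟩, fun a ha => ha.elim And.right fun ha =>
        absurd (ZFSet.pair_mem_prod.1 (hB.1 ha)).1 (ZFSet.mem_irrefl α)⟩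
    · obtain ⟨a, ha, huniq⟩ := hB.2 α hα
      exact ⟨a, .inr ha, fun a' ha' => ha'.elim
        (fun h => absurd (h.1 ▸ hα) (ZFSet.mem_irrefl γ)) (huniq a')⟩

/-- The family `{a_α | α < β} ∪ {ω \ a_α | β ≤ α}` of the definition of a free sequence
`B = ⟨a_α | α < γ⟩`. -/
def signedTerms (B β : ZFSet.{u}) : Set (Set ℕ) :=
  {s | ∃ α a, ZFSet.pair α a ∈ B ∧ ((α ∈ β ∧ s = natSet a) ∨ (α ∉ β ∧ s = (natSet a)ᶜ))}

theorem signedTerms_insert_of_mem (hγ : γ ∈ β) :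
    signedTerms (insert (ZFSet.pair γ X) B) β = insert (natSet X) (signedTerms B β) := by
  ext s
  simp [signedTerms, ZFSet.pair_inj, or_and_right, exists_or, hγ]

theorem signedTerms_insert_of_notMem (hγ : γ ∉ β) :
    signedTerms (insert (ZFSet.pair γ X) B) β = insert (natSet X)ᶜ (signedTerms B β) := by
  ext s
  simp [signedTerms, ZFSet.pair_inj, or_and_right, exists_or, hγ]

theorem signedTerms_eq (hB : ∀ α a, ZFSet.pair α a ∈ B → α ∈ β) :
    signedTerms B β = {s | ∃ α a, ZFSet.pair α a ∈ B ∧ s = natSet a} := by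
  ext s
  refine exists_congr fun α => exists_congr fun a => and_congr_right fun ha => ?_
  simp [hB α a ha]

theorem centered_insert_signedTerms_iff (hB : ∀ α a, ZFSet.pair α a ∈ B → α ∈ β) {s : Set ℕ} :
    Centered (insert s (signedTerms B β)) ↔ ∀ S ∈ sequenceFilter B, (S ∩ s).Infinite := by
  rw [signedTerms_eq hB, centered_insert_iff, sequenceFilter]

theorem IsFreeSequence.inter_infinite (hB : ZFSet.IsFunc γ (ZFSet.powerset ZFSet.omega) B)
    (hX : IsFreeSequence (insert γ γ) (insert (ZFSet.pair γ X) B)) {S : Set ℕ}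
    (hS : S ∈ sequenceFilter B) : (S ∩ natSet X).Infinite := by
  have hcent := hX.2.2 (insert γ γ) (.inr rfl)
  rw [← signedTerms, signedTerms_insert_of_mem (ZFSet.mem_insert γ γ),
    centered_insert_signedTerms_iff fun α a ha =>
      ZFSet.mem_insert_of_mem _ (mem_of_pair_mem_of_isFunc hB ha).1] at hcent
  exact hcent S hS

theorem IsFreeSequence.insert_of_sdiff_finite
    (hX : IsFreeSequence (insert γ γ) (insert (ZFSet.pair γ X) B))
    (hB : ZFSet.IsFunc γ (ZFSet.powerset ZFSet.omega) B) (hYω : Y ⊆ ZFSet.omega)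
    (hYX : (natSet Y \ natSet X).Finite) (hY : ∀ S ∈ sequenceFilter B, (S ∩ natSet Y).Infinite) :
    IsFreeSequence (insert γ γ) (insert (ZFSet.pair γ Y) B) := by
  refine ⟨hX.1, isFunc_insert_pair hB (ZFSet.mem_powerset.2 hYω), fun β hβ => ?_⟩
  have hcent := hX.2.2 β hβ
  rw [← signedTerms] at hcent ⊢
  by_cases hγβ : γ ∈ β
  · have hβγ : β = insert γ γ := hβ.resolve_left fun h =>
      (ZFSet.mem_insert_iff.1 h).elim (fun h => ZFSet.mem_irrefl γ (h ▸ hγβ))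
        fun h => ZFSet.mem_asymm h hγβ
    rw [signedTerms_insert_of_mem hγβ, centered_insert_signedTerms_iff fun α a ha =>
      hβγ ▸ ZFSet.mem_insert_of_mem _ (mem_of_pair_mem_of_isFunc hB ha).1]
    exact hY
  · rw [signedTerms_insert_of_notMem hγβ] at hcent ⊢
    exact hcent.insert_of_sdiff_finite (by rwa [Set.sdiff_compl, Set.inter_comm,
      ← Set.sdiff_eq])

end FreeSequence

theorem mainTheorem5 (V W : Set ZFSet.{u}) (hV : IsTransitiveModel V) (hW : IsTransitiveModel W)
    (hVW : V ⊆ W) (A γ B : ZFSet.{u}) (hA : A ∈ V) (hB : B ∈ V)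
    (hAV : IsDenseSystem V A) (hBV : IsAssociated V A γ B)
    (hCohen : CohenPreserving V W) (hcov : CountableCovering V W A)
    (hAW : IsDenseSystem W A) :
    IsAssociated W A γ B := by
  have hfilter : densityFilter W A = densityFilter V A := densityFilter_eq_of_refines hVW
    fun D => hCohen.exists_refines hV hW hVW hA (fun a ha => (hAV.1.1 a ha).1) hcov
  have hseq : sequenceFilter B = densityFilter V A := hBV.sequenceFilter_eq hV hA hB
  refine ⟨⟨hBV.1.1, fun X hX hXω hfree => ?_⟩, fun X _ _ => by rw [hseq, hfilter]⟩
  have hBfun := hBV.1.1.2.1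
  rw [← hfilter] at hseq
  obtain ⟨h, hh, hhX⟩ := hAW.exists_cohenInter_sdiff_finite hW (hVW hA) hX hXω
    (hseq ▸ sequenceFilter_le_cofinite) fun hXc =>
      hfree.inter_infinite hBfun (hseq ▸ hXc) (by simp)
  obtain ⟨Y, hY, hYω, hYh⟩ := hV.exists_natSet_eq_cohenInter hA hh
  refine hBV.1.2 Y hY hYω (hfree.insert_of_sdiff_finite hBfun hYω (hYh ▸ hhX) fun S hS => ?_)
  obtain ⟨g, hg, hhg, hgS⟩ := exists_cohenInter_subset (hseq ▸ hS) hh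
  rw [hYh]
  exact (hAV.1.infinite_cohenInter hg).mono (Set.subset_inter hgS (cohenInter_anti hhg))
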